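/- Let $K$ be a field of prime characteristic $p$, let $X$ be a finite set of indeterminates, and let $V$ be a $K[X]$-module (of arbitrary, possibly infinite, dimension over $K$). Let $L(V)$ be the free Lie algebra on the $K$-vector space $V$, let $L^p(V)\subseteq L(V)$ be its homogeneous component of degree $p$, that is, the $K$-span of all left-normed Lie products $[a_1,\dots,a_p]$ with $a_i\in V$, and let $L(V)''=[L(V)',L(V)']$, where $L(V)'=[L(V),L(V)]$. Let $T^p(V)=V\otimes_K\cdots\otimes_K V$ ($p$ factors). Regard $L(V)$ and $T^p(V)$ as $K[X]$-modules under the derivation action, in which $K$ acts by scalars and each $x\in X$ acts by $$x\cdot(a_1\otimes\cdots\otimes a_p)=\sum_{i=1}^p a_1\otimes\cdots\otimes xa_i\otimes\cdots\otimes a_p$$ on $T^p(V)$, and on $L(V)$ as the derivation extending $a\mapsto xa$ on $V$. Then $L^p(V)$ and $B^p(V)=L^p(V)\cap L(V)''$ are $K[X]$-submodules of $L(V)$, and the canonical homomorphism from $L(V)$ to the tensor algebra of $V$ restricts to an injective $K[X]$-module homomorphism $\nu_p: L^p(V)\to T^p(V)$. (i) $B^p(V)$, identified with its image under $\nu_p$,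 is a direct summand of the $K[X]$-module $T^p(V)$. (ii) If $V$ is a free $K[X]$-module, then $B^p(V)$ is a projective $K[X]$-module. -/

import Mathlib

open scoped TensorProduct DirectSum

noncomputable section

namespace LiePower

/-! ### Modules for a polynomial ring from commuting operators -/

section Action

variable {σ K M : Type*} [CommRing K] [AddCommGroup M] [Module K M]

/-- Commuting `K`-linear operators `D x`, `x ∈ σ`, on `M` give an algebra homomorphism from the
polynomial ring `K[σ]` to the endomorphisms of `M`, with `x ↦ D x`. -/
def polyAct (D : σ → Module.End K M) (h : ∀ x y, D x * D y = D y * D x) :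
    MvPolynomial σ K →ₐ[K] Module.End K M :=
  letI : CommSemiring (Algebra.adjoin K (Set.range D)) :=
    { (Algebra.adjoin K (Set.range D)).toSemiring with
      mul_comm := (Algebra.isMulCommutative_adjoin K
        (by rintro _ ⟨x, rfl⟩ _ ⟨y, rfl⟩; exact h x y)).is_comm.comm }
  (Algebra.adjoin K (Set.range D)).val.comp
    (MvPolynomial.aeval fun x =>
      (⟨D x, Algebra.subset_adjoin ⟨x, rfl⟩⟩ : Algebra.adjoin K (Set.range D)))

@[simp]
theorem polyAct_X (D : σ → Module.End K M) (h : ∀ x y, D x * D y = D y * D x) (x : σ) :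
    polyAct D h (MvPolynomial.X x) = D x := by
  simp [polyAct]

theorem polyAct_mem (D : σ → Module.End K M) (h : ∀ x y, D x * D y = D y * D x)
    (N : Submodule K M) (hN : ∀ x, ∀ m ∈ N, D x m ∈ N) (q : MvPolynomial σ K) :
    ∀ m ∈ N, polyAct D h q m ∈ N := by
  induction q using MvPolynomial.induction_on with
  | C a =>
    intro m hm
    rw [← MvPolynomial.algebraMap_eq, AlgHom.commutes]
    simpa using N.smul_mem a hm
  | add q r hq hr =>
    intro m hm
    simpa using N.add_mem (hq m hm) (hr m hm)
  | mul_X q x hq =>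
    intro m hm
    simpa using hq _ (hN x m hm)

theorem polyAct_comm {M' : Type*} [AddCommGroup M'] [Module K M']
    (D : σ → Module.End K M) (h : ∀ x y, D x * D y = D y * D x)
    (D' : σ → Module.End K M') (h' : ∀ x y, D' x * D' y = D' y * D' x)
    (f : M →ₗ[K] M') (hf : ∀ x m, f (D x m) = D' x (f m)) (q : MvPolynomial σ K) :
    ∀ m, f (polyAct D h q m) = polyAct D' h' q (f m) := by
  induction q using MvPolynomial.induction_on with
  | C a =>
    intro m
    rw [← MvPolynomial.algebraMap_eq, AlgHom.commutes, AlgHom.commutes]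
    simp
  | add q r hq hr =>
    intro m
    simp [hq, hr]
  | mul_X q x hq =>
    intro m
    simp [hq, hf]

/-- Multiplication by the indeterminate `x`, as a `K`-linear operator. -/
def mulX (K V : Type*) {σ : Type*} [CommRing K] [AddCommGroup V] [Module K V]
    [Module (MvPolynomial σ K) V] [IsScalarTower K (MvPolynomial σ K) V] (x : σ) :
    Module.End K V :=
  Module.toModuleEnd K (S := MvPolynomial σ K) V (MvPolynomial.X x)

theorem mulX_apply {V : Type*} [AddCommGroup V] [Module K V]
    [Module (MvPolynomial σ K) V] [IsScalarTower K (MvPolynomial σ K) V] (x : σ) (v : V) :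
    mulX K V x v = (MvPolynomial.X x : MvPolynomial σ K) • v := rfl

theorem mulX_comm {V : Type*} [AddCommGroup V] [Module K V]
    [Module (MvPolynomial σ K) V] [IsScalarTower K (MvPolynomial σ K) V] (x y : σ) :
    mulX K V x * mulX K V y = mulX K V y * mulX K V x := by
  ext v
  simp only [Module.End.mul_apply, mulX_apply, smul_smul, mul_comm]

end Action

/-! ### Tensor powers and the derivation action on them -/

section Tensor

variable {K V : Type*} [CommRing K] [AddCommGroup V] [Module K V]

/-- The operator `a₁ ⊗ ⋯ ⊗ aₙ ↦ ∑ i, a₁ ⊗ ⋯ ⊗ f aᵢ ⊗ ⋯ ⊗ aₙ` on the `n`-th tensor power. -/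
def tensorDer (f : Module.End K V) (n : ℕ) : Module.End K (⨂[K]^n V) :=
  ∑ i : Fin n, PiTensorProduct.map (Function.update (fun _ => LinearMap.id) i f)

theorem map_update_tprod (f : Module.End K V) {n : ℕ} (i : Fin n) (a : Fin n → V) :
    PiTensorProduct.map (Function.update (fun _ => LinearMap.id) i f)
      (PiTensorProduct.tprod K a) =
      PiTensorProduct.tprod K (Function.update a i (f (a i))) := by
  rw [PiTensorProduct.map_tprod]
  congr 1
  ext j
  by_cases hj : j = i
  · subst hj; simp
  · simp [hj]

theorem tensorDer_tprod (f : Module.End K V) (n : ℕ) (a : Fin n → V) :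
    tensorDer f n (PiTensorProduct.tprod K a) =
      ∑ i, PiTensorProduct.tprod K (Function.update a i (f (a i))) := by
  simp only [tensorDer, LinearMap.sum_apply, map_update_tprod]

theorem tensorDer_comm (f g : Module.End K V) (h : f * g = g * f) (n : ℕ) :
    tensorDer f n * tensorDer g n = tensorDer g n * tensorDer f n := by
  ext a
  simp only [LinearMap.compMultilinearMap_apply, Module.End.mul_apply, tensorDer_tprod, map_sum]
  rw [Finset.sum_comm]
  refine Finset.sum_congr rfl fun i _ => Finset.sum_congr rfl fun j _ => ?_
  by_cases hij : i = j
  · subst hij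
    simpa using congrArg (fun w => PiTensorProduct.tprod K (Function.update a i w))
      (LinearMap.congr_fun h (a i))
  · rw [Function.update_of_ne hij, Function.update_of_ne (Ne.symm hij), Function.update_comm hij]

end Tensor

section TensorModule

variable {σ K V : Type*} [CommRing K] [AddCommGroup V] [Module K V]
  [Module (MvPolynomial σ K) V] [IsScalarTower K (MvPolynomial σ K) V]

/-- The tensor power `Tⁿ(V)` of a `K[σ]`-module `V` is a `K[σ]`-module under the derivation
action `x • (a₁ ⊗ ⋯ ⊗ aₙ) = ∑ i, a₁ ⊗ ⋯ ⊗ x • aᵢ ⊗ ⋯ ⊗ aₙ`. -/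
instance tensorModule (n : ℕ) : Module (MvPolynomial σ K) (⨂[K]^n V) :=
  Module.compHom _ (polyAct (fun x : σ => tensorDer (mulX K V x) n)
    fun x y => tensorDer_comm _ _ (mulX_comm x y) n).toRingHom

theorem tensor_smul_def (n : ℕ) (q : MvPolynomial σ K) (t : ⨂[K]^n V) :
    q • t = polyAct (fun x : σ => tensorDer (mulX K V x) n)
      (fun x y => tensorDer_comm _ _ (mulX_comm x y) n) q t := rfl

theorem X_smul_tprod (n : ℕ) (x : σ) (a : Fin n → V) :
    (MvPolynomial.X x : MvPolynomial σ K) • PiTensorProduct.tprod K a =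
      ∑ i, PiTensorProduct.tprod K
        (Function.update a i ((MvPolynomial.X x : MvPolynomial σ K) • a i)) := by
  rw [tensor_smul_def, polyAct_X, tensorDer_tprod]
  rfl

instance tensorScalarTower (n : ℕ) : IsScalarTower K (MvPolynomial σ K) (⨂[K]^n V) :=
  ⟨fun c q t => by rw [tensor_smul_def, tensor_smul_def, map_smul, LinearMap.smul_apply]⟩

end TensorModule

/-! ### The free Lie algebra on a vector space -/

section FreeLie

variable (K V : Type*) [CommRing K] [AddCommGroup V] [Module K V]

/-- The Lie ideal of the free Lie algebra on the set `V` that forces the canonical map from `V`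
to be `K`-linear. -/
def linIdeal : LieIdeal K (FreeLieAlgebra K V) :=
  LieSubmodule.lieSpan K (FreeLieAlgebra K V)
    {z | (∃ a b : V, z = FreeLieAlgebra.of K (a + b) - (FreeLieAlgebra.of K a +
        FreeLieAlgebra.of K b)) ∨
      ∃ (c : K) (a : V), z = FreeLieAlgebra.of K (c • a) - c • FreeLieAlgebra.of K a}

/-- The free Lie algebra `L(V)` on the `K`-module `V`: the Lie algebra with a `K`-linear map
from `V` that is universal among `K`-linear maps from `V` to Lie algebras. -/
def FreeLie : Type _ := FreeLieAlgebra K V ⧸ linIdeal K V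

instance : LieRing (FreeLie K V) := inferInstanceAs (LieRing (FreeLieAlgebra K V ⧸ linIdeal K V))

instance : LieAlgebra K (FreeLie K V) :=
  inferInstanceAs (LieAlgebra K (FreeLieAlgebra K V ⧸ linIdeal K V))

variable {K V}

/-- The projection from the free Lie algebra on the set `V`. -/
def FreeLie.mk : FreeLieAlgebra K V →ₗ⁅K⁆ FreeLie K V where
  toFun := LieSubmodule.Quotient.mk (N := linIdeal K V)
  map_add' _ _ := rfl
  map_smul' _ _ := rfl
  map_lie' := rfl

theorem FreeLie.mk_surjective : Function.Surjective (FreeLie.mk : FreeLieAlgebra K V → FreeLie K V) :=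
  Submodule.Quotient.mk_surjective _

theorem FreeLie.mk_eq_zero {z : FreeLieAlgebra K V} (hz : z ∈ linIdeal K V) :
    FreeLie.mk z = 0 :=
  (Submodule.Quotient.mk_eq_zero _).2 hz

variable (K) in
/-- The canonical `K`-linear map `V → L(V)`. -/
def FreeLie.ι : V →ₗ[K] FreeLie K V where
  toFun v := FreeLie.mk (FreeLieAlgebra.of K v)
  map_add' a b := by
    rw [← map_add, ← sub_eq_zero, ← map_sub]
    exact mk_eq_zero (LieSubmodule.subset_lieSpan (Or.inl ⟨a, b, rfl⟩))
  map_smul' c a := by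
    rw [RingHom.id_apply, ← map_smul, ← sub_eq_zero, ← map_sub]
    exact mk_eq_zero (LieSubmodule.subset_lieSpan (Or.inr ⟨c, a, rfl⟩))

variable {L : Type*} [LieRing L] [LieAlgebra K L]

/-- The universal property of `L(V)`: a `K`-linear map from `V` to a Lie algebra extends to a
homomorphism of Lie algebras. -/
def FreeLie.lift (f : V →ₗ[K] L) : FreeLie K V →ₗ⁅K⁆ L :=
  have h : linIdeal K V ≤ (FreeLieAlgebra.lift K (f : V → L)).ker := by
    refine LieSubmodule.lieSpan_le.2 ?_
    rintro _ (⟨a, b, rfl⟩ | ⟨c, a, rfl⟩) <;> simp [LieHom.mem_ker]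
  { Submodule.liftQ (linIdeal K V).toSubmodule 
      (FreeLieAlgebra.lift K (f : V → L) : FreeLieAlgebra K V →ₗ[K] L)
      (fun z hz => LieHom.mem_ker.1 (h hz)) with
    map_lie' := by
      intro x y
      obtain ⟨x, rfl⟩ := FreeLie.mk_surjective x
      obtain ⟨y, rfl⟩ := FreeLie.mk_surjective y
      exact LieHom.map_lie (FreeLieAlgebra.lift K f) x y }

@[simp]
theorem FreeLie.lift_ι (f : V →ₗ[K] L) (v : V) : FreeLie.lift f (FreeLie.ι K v) = f v :=
  FreeLieAlgebra.lift_of_apply f v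

theorem FreeLie.hom_ext {F G : FreeLie K V →ₗ⁅K⁆ L}
    (h : ∀ v, F (FreeLie.ι K v) = G (FreeLie.ι K v)) : F = G := by
  have : F.comp FreeLie.mk = G.comp FreeLie.mk := FreeLieAlgebra.hom_ext h
  ext x
  obtain ⟨x, rfl⟩ := FreeLie.mk_surjective x
  exact LieHom.congr_fun this x

theorem FreeLie.lieSpan_ι :
    LieSubalgebra.lieSpan K (FreeLie K V) (Set.range (FreeLie.ι K (V := V))) = ⊤ := by
  set S := LieSubalgebra.lieSpan K (FreeLie K V) (Set.range (FreeLie.ι K (V := V))) with hS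
  let g : V →ₗ[K] S := (FreeLie.ι K).codRestrict S.toSubmodule
    fun v => LieSubalgebra.subset_lieSpan ⟨v, rfl⟩
  have h : S.incl.comp (FreeLie.lift g) = LieHom.id := FreeLie.hom_ext fun v => by
    simp [g]
    rfl
  rw [eq_top_iff]
  intro x _
  have := LieHom.congr_fun h x
  rw [LieHom.id_apply] at this
  rw [← this]
  exact (FreeLie.lift g x).2

theorem FreeLie.induction {P : FreeLie K V → Prop} (hι : ∀ v, P (FreeLie.ι K v)) (h0 : P 0)
    (hadd : ∀ x y, P x → P y → P (x + y)) (hsmul : ∀ (c : K) x, P x → P (c • x))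
    (hlie : ∀ x y, P x → P y → P ⁅x, y⁆) (x : FreeLie K V) : P x := by
  have hx : x ∈ LieSubalgebra.lieSpan K (FreeLie K V) (Set.range (FreeLie.ι K (V := V))) := by
    rw [lieSpan_ι]; trivial
  induction hx using LieSubalgebra.lieSpan_induction with
  | mem x hx => obtain ⟨v, rfl⟩ := hx; exact hι v
  | zero => exact h0
  | add x y _ _ hx hy => exact hadd _ _ hx hy
  | smul t x _ hx => exact hsmul _ _ hx
  | lie x y _ _ hx hy => exact hlie _ _ hx hy

end FreeLie

/-! ### The derivation of `L(V)` that extends an operator on `V` -/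

section Derivation

/-- The Lie algebra `L ⊗ K[ε]`, `ε² = 0`, whose elements `(a, b)` stand for `a + ε b`. -/
structure DualLie (L : Type*) where
  /-- the constant part -/
  fst : L
  /-- the coefficient of `ε` -/
  snd : L

namespace DualLie

@[ext]
theorem ext {L : Type*} {y z : DualLie L} (h : y.fst = z.fst) (h' : y.snd = z.snd) : y = z := by
  cases y; cases z; simp_all

variable {K L : Type*} [CommRing K] [LieRing L] [LieAlgebra K L]

/-- The underlying additive structure is that of `L × L`. -/
def equivProd : DualLie L ≃ L × L where
  toFun z := (z.fst, z.snd)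
  invFun z := ⟨z.1, z.2⟩
  left_inv _ := rfl
  right_inv _ := rfl

instance : AddCommGroup (DualLie L) := equivProd.addCommGroup

instance : Module K (DualLie L) := equivProd.module K

@[simp] theorem add_fst (y z : DualLie L) : (y + z).fst = y.fst + z.fst := rfl
@[simp] theorem add_snd (y z : DualLie L) : (y + z).snd = y.snd + z.snd := rfl
@[simp] theorem zero_fst : (0 : DualLie L).fst = 0 := rfl
@[simp] theorem zero_snd : (0 : DualLie L).snd = 0 := rfl
@[simp] theorem smul_fst (c : K) (z : DualLie L) : (c • z).fst = c • z.fst := rfl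
@[simp] theorem smul_snd (c : K) (z : DualLie L) : (c • z).snd = c • z.snd := rfl

instance : Bracket (DualLie L) (DualLie L) :=
  ⟨fun y z => ⟨⁅y.fst, z.fst⁆, ⁅y.fst, z.snd⁆ + ⁅y.snd, z.fst⁆⟩⟩

@[simp] theorem lie_fst (y z : DualLie L) : ⁅y, z⁆.fst = ⁅y.fst, z.fst⁆ := rfl
@[simp] theorem lie_snd (y z : DualLie L) :
    ⁅y, z⁆.snd = ⁅y.fst, z.snd⁆ + ⁅y.snd, z.fst⁆ := rfl

instance : LieRing (DualLie L) where
  add_lie x y z := by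
    ext
    · simp
    · simp
      abel
  lie_add x y z := by
    ext
    · simp
    · simp
      abel
  lie_self x := by
    ext
    · simp
    · rw [lie_snd, ← lie_skew x.fst x.snd]
      exact neg_add_cancel _
  leibniz_lie x y z := by
    ext
    · simp
    · simp
      abel

instance : LieAlgebra K (DualLie L) where
  lie_smul c x y := by ext <;> simp

end DualLie

variable {K V : Type*} [CommRing K] [AddCommGroup V] [Module K V]

/-- The homomorphism `L(V) → L(V) ⊗ K[ε]` with `v ↦ v + ε f(v)`. -/
def derHom (f : Module.End K V) : FreeLie K V →ₗ⁅K⁆ DualLie (FreeLie K V) :=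
  FreeLie.lift
    { toFun := fun v => ⟨FreeLie.ι K v, FreeLie.ι K (f v)⟩
      map_add' := fun a b => by ext <;> simp
      map_smul' := fun c a => by ext <;> simp }

theorem derHom_fst (f : Module.End K V) (u : FreeLie K V) : (derHom f u).fst = u := by
  induction u using FreeLie.induction with
  | hι v => simp [derHom]
  | h0 => simp
  | hadd x y hx hy => simp [hx, hy]
  | hsmul c x hx => simp [hx]
  | hlie x y hx hy => simp [hx, hy]

/-- The derivation of the Lie algebra `L(V)` that extends the operator `f` on `V`. -/
def lieDer (f : Module.End K V) : LieDerivation K (FreeLie K V) (FreeLie K V) where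
  toFun u := (derHom f u).snd
  map_add' x y := by simp
  map_smul' c x := by simp
  leibniz' x y := by
    change (derHom f ⁅x, y⁆).snd = ⁅x, (derHom f y).snd⁆ - ⁅y, (derHom f x).snd⁆
    rw [LieHom.map_lie, DualLie.lie_snd, derHom_fst, derHom_fst, sub_eq_add_neg, lie_skew]

@[simp]
theorem lieDer_ι (f : Module.End K V) (v : V) :
    lieDer f (FreeLie.ι K v) = FreeLie.ι K (f v) := by
  change (derHom f _).snd = _
  simp [derHom]

theorem lieDer_comm (f g : Module.End K V) (h : f * g = g * f) :
    (lieDer f).toLinearMap * (lieDer g).toLinearMap =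
      (lieDer g).toLinearMap * (lieDer f).toLinearMap := by
  ext u
  simp only [Module.End.mul_apply, LieDerivation.coeFn_coe]
  induction u using FreeLie.induction with
  | hι v =>
    simpa using congrArg (FreeLie.ι K) (LinearMap.congr_fun h v)
  | h0 => simp
  | hadd x y hx hy => simp [hx, hy]
  | hsmul c x hx => simp [hx]
  | hlie x y hx hy =>
    simp only [LieDerivation.apply_lie_eq_add, map_add, hx, hy]
    abel

end Derivation

section LieModule

variable {σ K V : Type*} [CommRing K] [AddCommGroup V] [Module K V]
  [Module (MvPolynomial σ K) V] [IsScalarTower K (MvPolynomial σ K) V]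

/-- For a `K[σ]`-module `V`, the free Lie algebra `L(V)` is a `K[σ]`-module under the derivation
action: each indeterminate `x` acts as the derivation that extends `v ↦ x • v`. -/
instance lieModule : Module (MvPolynomial σ K) (FreeLie K V) :=
  Module.compHom _ (polyAct (fun x : σ => (lieDer (mulX K V x)).toLinearMap)
    fun x y => lieDer_comm _ _ (mulX_comm x y)).toRingHom

theorem lie_smul_def (q : MvPolynomial σ K) (u : FreeLie K V) :
    q • u = polyAct (fun x : σ => (lieDer (mulX K V x)).toLinearMap)
      (fun x y => lieDer_comm _ _ (mulX_comm x y)) q u := rfl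

instance lieScalarTower : IsScalarTower K (MvPolynomial σ K) (FreeLie K V) :=
  ⟨fun c q t => by rw [lie_smul_def, lie_smul_def, map_smul, LinearMap.smul_apply]⟩

theorem X_smul_ι (x : σ) (v : V) :
    (MvPolynomial.X x : MvPolynomial σ K) • FreeLie.ι K v =
      FreeLie.ι K ((MvPolynomial.X x : MvPolynomial σ K) • v) := by
  rw [lie_smul_def, polyAct_X]
  exact lieDer_ι _ _

theorem X_smul_lie (x : σ) (u w : FreeLie K V) :
    (MvPolynomial.X x : MvPolynomial σ K) • ⁅u, w⁆ =
      ⁅(MvPolynomial.X x : MvPolynomial σ K) • u, w⁆ +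
        ⁅u, (MvPolynomial.X x : MvPolynomial σ K) • w⁆ := by
  simp only [lie_smul_def, polyAct_X]
  exact (LieDerivation.apply_lie_eq_add _ _ _).trans (add_comm _ _)

end LieModule

/-! ### Lie powers, the second derived algebra, and their intersection -/

section Powers

section Carriers

variable (K : Type*) {V : Type*} [CommRing K] [AddCommGroup V] [Module K V]

/-- The left-normed Lie product `[a, b₁, …, bₖ] = [⋯[[a, b₁], b₂], …, bₖ]` in `L(V)`. -/
def leftNormed (a : V) (l : List V) : FreeLie K V :=
  l.foldl (fun u b => ⁅u, FreeLie.ι K b⁆) (FreeLie.ι K a)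

variable (V) in
/-- The homogeneous component `Lⁿ(V)` as a `K`-submodule: the span of all left-normed Lie products
`[a₁, …, aₙ]` with `aᵢ ∈ V`. -/
def liePowerSpan (n : ℕ) : Submodule K (FreeLie K V) :=
  Submodule.span K {u | ∃ (a : V) (l : List V), l.length + 1 = n ∧ u = leftNormed K a l}

variable {K}

theorem leftNormed_mem (a : V) (l : List V) :
    leftNormed K a l ∈ liePowerSpan K V (l.length + 1) :=
  Submodule.subset_span ⟨a, l, rfl, rfl⟩

theorem lie_ι_mem {n : ℕ} {u : FreeLie K V} (hu : u ∈ liePowerSpan K V n) (b : V) :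
    ⁅u, FreeLie.ι K b⁆ ∈ liePowerSpan K V (n + 1) := by
  induction hu using Submodule.span_induction with
  | mem u hu =>
    obtain ⟨a, l, hl, rfl⟩ := hu
    refine Submodule.subset_span ⟨a, l ++ [b], by simp [hl], by simp [leftNormed]⟩
  | zero => simp
  | add x y _ _ hx hy => simpa using Submodule.add_mem _ hx hy
  | smul c x _ hx => simpa using Submodule.smul_mem _ c hx

theorem lieDer_leftNormed (f : Module.End K V) (a : V) (l : List V) :
    lieDer f (leftNormed K a l) ∈ liePowerSpan K V (l.length + 1) := by
  induction l using List.reverseRecOn with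
  | nil => simpa [leftNormed] using leftNormed_mem (K := K) (f a) []
  | append_singleton l b ih =>
    have h : leftNormed K a (l ++ [b]) = ⁅leftNormed K a l, FreeLie.ι K b⁆ := by
      simp [leftNormed]
    rw [h, LieDerivation.apply_lie_eq_add, lieDer_ι, List.length_append, List.length_singleton]
    exact Submodule.add_mem _ (lie_ι_mem (leftNormed_mem a l) _) (lie_ι_mem ih b)

theorem lieDer_liePowerSpan (f : Module.End K V) (n : ℕ) (u : FreeLie K V)
    (hu : u ∈ liePowerSpan K V n) : lieDer f u ∈ liePowerSpan K V n := by
  induction hu using Submodule.span_induction with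
  | mem u hu =>
    obtain ⟨a, l, rfl, rfl⟩ := hu
    exact lieDer_leftNormed f a l
  | zero => simp
  | add x y _ _ hx hy => simpa using Submodule.add_mem _ hx hy
  | smul c x _ hx => simpa using Submodule.smul_mem _ c hx

theorem lieDer_derivedSeries {L : Type*} [LieRing L] [LieAlgebra K L] (D : LieDerivation K L L)
    (k : ℕ) : ∀ u ∈ LieAlgebra.derivedSeries K L k, D u ∈ LieAlgebra.derivedSeries K L k := by
  induction k with
  | zero => intro u _; exact LieSubmodule.mem_top _
  | succ k ih =>
    intro u hu
    rw [LieAlgebra.derivedSeries_def, LieAlgebra.derivedSeriesOfIdeal_succ] at hu ⊢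
    rw [← LieSubmodule.mem_toSubmodule, LieSubmodule.lieIdeal_oper_eq_linear_span'] at hu
    induction hu using Submodule.span_induction with
    | mem u hu =>
      obtain ⟨x, hx, y, hy, rfl⟩ := hu
      rw [LieDerivation.apply_lie_eq_add]
      exact add_mem (LieSubmodule.lie_mem_lie hx (ih y hy)) (LieSubmodule.lie_mem_lie (ih x hx) hy)
    | zero => simp
    | add x y _ _ hx hy => simpa using add_mem hx hy
    | smul c x _ hx => simpa using (LieSubmodule.toSubmodule _).smul_mem c hx

end Carriers

variable (σ K V : Type*) [CommRing K] [AddCommGroup V] [Module K V]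
  [Module (MvPolynomial σ K) V] [IsScalarTower K (MvPolynomial σ K) V]

/-- The `n`-th Lie power `Lⁿ(V)`, a `K[σ]`-submodule of `L(V)`. -/
def liePower (n : ℕ) : Submodule (MvPolynomial σ K) (FreeLie K V) where
  __ := (liePowerSpan K V n).toAddSubmonoid
  smul_mem' q u hu := polyAct_mem (fun x : σ => (lieDer (mulX K V x)).toLinearMap)
    (fun x y => lieDer_comm _ _ (mulX_comm x y)) (liePowerSpan K V n)
    (fun x u hu => lieDer_liePowerSpan (mulX K V x) n u hu) q u hu

/-- The second derived algebra `L(V)'' = [L(V)', L(V)']` with `L(V)' = [L(V), L(V)]`, a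
`K[σ]`-submodule of `L(V)`. -/
def secondDerived : Submodule (MvPolynomial σ K) (FreeLie K V) where
  __ := (LieAlgebra.derivedSeries K (FreeLie K V) 2).toSubmodule.toAddSubmonoid
  smul_mem' q u hu := polyAct_mem (fun x : σ => (lieDer (mulX K V x)).toLinearMap)
    (fun x y => lieDer_comm _ _ (mulX_comm x y))
    (LieAlgebra.derivedSeries K (FreeLie K V) 2).toSubmodule
    (fun x u hu => lieDer_derivedSeries (lieDer (mulX K V x)) 2 u hu) q u hu

/-- `Bⁿ(V) = Lⁿ(V) ∩ L(V)''`. -/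
def metabKernel (n : ℕ) : Submodule (MvPolynomial σ K) (FreeLie K V) :=
  liePower σ K V n ⊓ secondDerived σ K V

end Powers

/-! ### The canonical map from `L(V)` to the tensor powers -/

section Embedding

theorem update_append_left {V : Type*} {n m : ℕ} (a : Fin n → V) (b : Fin m → V) (i : Fin n)
    (v : V) : Function.update (Fin.append a b) (Fin.castAdd m i) v =
      Fin.append (Function.update a i v) b := by
  ext j
  refine Fin.addCases (fun j => ?_) (fun j => ?_) j
  · by_cases h : j = i
    · subst h; simp
    · rw [Function.update_of_ne (by simpa using h), Fin.append_left, Fin.append_left,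
        Function.update_of_ne h]
  · rw [Function.update_of_ne (by simp [Fin.ext_iff]; omega), Fin.append_right, Fin.append_right]

theorem update_append_right {V : Type*} {n m : ℕ} (a : Fin n → V) (b : Fin m → V) (i : Fin m)
    (v : V) : Function.update (Fin.append a b) (Fin.natAdd n i) v =
      Fin.append a (Function.update b i v) := by
  ext j
  refine Fin.addCases (fun j => ?_) (fun j => ?_) j
  · rw [Function.update_of_ne (by simp [Fin.ext_iff]; omega), Fin.append_left, Fin.append_left]
  · by_cases h : j = i
    · subst h; simp
    · rw [Function.update_of_ne (by simpa using h), Fin.append_right, Fin.append_right,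
        Function.update_of_ne h]

variable {K V : Type*} [CommRing K] [AddCommGroup V] [Module K V]

section

attribute [local instance] LieRing.ofAssociativeRing

variable (K V) in
/-- The canonical Lie homomorphism from `L(V)` to the tensor algebra `T(V)`, which extends the
identity of `V`, followed by the identification `T(V) = ⨁ n, Tⁿ(V)`. -/
def toTensors : FreeLie K V →ₗ[K] ⨁ n, ⨂[K]^n V :=
  (TensorAlgebra.toDirectSum (R := K) (M := V)).toLinearMap ∘ₗ
    (FreeLie.lift (TensorAlgebra.ι K : V →ₗ[K] TensorAlgebra K V) :
      FreeLie K V →ₗ[K] TensorAlgebra K V)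

theorem toTensors_ι (v : V) : toTensors K V (FreeLie.ι K v) =
    DirectSum.of (fun n => ⨂[K]^n V) 1 (PiTensorProduct.tprod K fun _ => v) := by
  simp [toTensors]

theorem toTensors_lie (u w : FreeLie K V) : toTensors K V ⁅u, w⁆ =
    toTensors K V u * toTensors K V w - toTensors K V w * toTensors K V u := by
  simp [toTensors, Ring.lie_def]

end

/-- The operator on `⨁ n, Tⁿ(V)` that is `tensorDer f n` in degree `n`. -/
def totalDer (f : Module.End K V) : Module.End K (⨁ n, ⨂[K]^n V) :=
  DirectSum.lmap fun n => tensorDer f n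

theorem totalDer_of (f : Module.End K V) (n : ℕ) (t : ⨂[K]^n V) :
    totalDer f (DirectSum.of (fun n => ⨂[K]^n V) n t) =
      DirectSum.of (fun n => ⨂[K]^n V) n (tensorDer f n t) :=
  DirectSum.lmap_lof _ _ _

theorem totalDer_mul (f : Module.End K V) (s t : ⨁ n, ⨂[K]^n V) :
    totalDer f (s * t) = totalDer f s * t + s * totalDer f t := by
  induction s using DirectSum.induction_on with
  | zero => simp
  | add s s' hs hs' => simp only [add_mul, map_add, hs, hs']; abel
  | of n s =>
  induction t using DirectSum.induction_on with
  | zero => simp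
  | add t t' ht ht' => simp only [mul_add, map_add, ht, ht']; abel
  | of m t =>
  rw [totalDer_of, totalDer_of, DirectSum.of_mul_of, DirectSum.of_mul_of, DirectSum.of_mul_of,
    totalDer_of, ← map_add]
  congr 1
  simp only [TensorPower.gMul_eq_coe_linearMap]
  induction s using PiTensorProduct.induction_on with
  | add s s' hs hs' => simp only [map_add, LinearMap.add_apply, hs, hs']; abel
  | smul_tprod c a =>
  induction t using PiTensorProduct.induction_on with
  | add t t' ht ht' => simp only [map_add, ht, ht']; abel
  | smul_tprod d b =>
  simp only [map_smul, LinearMap.smul_apply, ← smul_add]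
  congr 2
  simp only [tensorDer_tprod, map_sum, LinearMap.sum_apply, ← TensorPower.gMul_eq_coe_linearMap,
    TensorPower.tprod_mul_tprod, Fin.sum_univ_add, Fin.append_left, Fin.append_right,
    update_append_left, update_append_right]

theorem toTensors_lieDer (f : Module.End K V) (u : FreeLie K V) :
    toTensors K V (lieDer f u) = totalDer f (toTensors K V u) := by
  induction u using FreeLie.induction with
  | hι v =>
    rw [lieDer_ι, toTensors_ι, toTensors_ι, totalDer_of, tensorDer_tprod]
    congr 1
    simp only [Fin.sum_univ_one]
    congr 1
    ext i
    simp [Subsingleton.elim i 0]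
  | h0 => simp
  | hadd x y hx hy => simp [hx, hy]
  | hsmul c x hx => simp [hx]
  | hlie x y hx hy =>
    simp only [LieDerivation.apply_lie_eq_add, map_add, map_sub, toTensors_lie, hx, hy,
      totalDer_mul]
    abel

end Embedding

section EmbeddingModule

variable (σ K V : Type*) [CommRing K] [AddCommGroup V] [Module K V]
  [Module (MvPolynomial σ K) V] [IsScalarTower K (MvPolynomial σ K) V]

/-- The degree `n` part `νₙ` of the canonical Lie homomorphism `L(V) → T(V)`. It is `K[σ]`-linear.
On `Lⁿ(V)` it sends `[a₁, …, aₙ]` to the corresponding iterated commutator in `Tⁿ(V)`. -/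
def toTensorPower (n : ℕ) : FreeLie K V →ₗ[MvPolynomial σ K] ⨂[K]^n V where
  toFun u := DirectSum.component K ℕ (fun n => ⨂[K]^n V) n (toTensors K V u)
  map_add' u w := by simp
  map_smul' q u := by
    refine polyAct_comm (fun x : σ => (lieDer (mulX K V x)).toLinearMap)
      (fun x y => lieDer_comm _ _ (mulX_comm x y))
      (fun x : σ => tensorDer (mulX K V x) n)
      (fun x y => tensorDer_comm _ _ (mulX_comm x y) n)
      (DirectSum.component K ℕ (fun n => ⨂[K]^n V) n ∘ₗ toTensors K V) (fun x u => ?_) q u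
    simp only [LinearMap.comp_apply, LieDerivation.coeFn_coe, toTensors_lieDer]
    rfl

end EmbeddingModule

end LiePower

end

noncomputable section

namespace LiePower

/-! ### Operators on and actions of the tensor algebra -/

section TensorAlgebraTools

variable {K V N : Type*} [CommRing K] [AddCommGroup V] [Module K V] [AddCommGroup N] [Module K N]

/-! Write T for the tensor algebra, L for L(V), and γ_k for the lower central series of L', so that
γ_1 = L' and γ_2 = L''. Everything rests on one K[X]-linear map φ = `symBracket (symCoeff K)` from T
to L that sends T^p into B^p and restricts to a bijection of B^p. Then T^p is the direct sum of B^p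
and the kernel of φ, and B^p is projective as soon as T^p is.

The map φ sends x ⊗ y_1 ⊗ ⋯ ⊗ y_m to a weighted sum of products in which some of the y are
symmetrized next to x and the others follow in order; the weight depends only on how many are
symmetrized. Because of the symmetrization, an element of L' at the end of a word passes through φ
as a plain bracket (`stateOp_toAlg`), which gives φ[u, w] = [φu, w] + [u, φw] for u, w in L'
(`symBracket_toAlg_lie`). Modulo L'' the letters after the second commute, and the weights are
chosen so that φ becomes x ⊗ y_1 ⊗ ⋯ ⊗ y_m ↦ (m + 1)⁻¹ ∑ [x, y_i, the other y's]
(`map_symBracket_word`). This is the identity on L^n for 2 ≤ n < p (`map_symBracket_toAlg`), while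
in degree p the coefficient is 0, so that φ(T^p) lies in L''. By the derivation rule, φ acts on the
degree p part of γ_k / γ_{k+1} as multiplication by k for k ≥ 2, since every factor has degree less
than p (`symBracket_sub_mem`). This part vanishes unless 2k ≤ p, so only invertible k matter, and
the filtration is finite: φ is bijective on B^p.

Injectivity of L^n → T^n for n ≤ p comes from derivations: `lieDer f u` depends only on the image of
u in T (`bracketing_toAlg`), so an element of the kernel is killed by all the derivations that count
a basis letter. Its monomials can be taken with all multiplicities divisible by p, and such a
monomial of degree at most p is [a, …, a] = 0.

For free V, the tensor power of positive degree is a retract of the free module K[X] ⊗ T^n, by a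
section prescribed on basis vectors in the first tensor factor (`coverMap_comp_tensorSection`). -/

theorem tensorAlgebra_left_induction {P : TensorAlgebra K V → Prop} (one : P 1)
    (add : ∀ s t, P s → P t → P (s + t)) (smul : ∀ (c : K) t, P t → P (c • t))
    (ι_mul : ∀ v t, P t → P (TensorAlgebra.ι K v * t)) (t : TensorAlgebra K V) : P t := by
  have h : ∀ a t, P t → P (a * t) := by
    intro a
    induction a using TensorAlgebra.induction with
    | algebraMap c => intro t ht; rw [← Algebra.smul_def]; exact smul c t ht
    | ι v => exact ι_mul v
    | mul a b ha hb => intro t ht; rw [mul_assoc]; exact ha _ (hb t ht)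
    | add a b ha hb => intro t ht; rw [add_mul]; exact add _ _ (ha t ht) (hb t ht)
  simpa using h t 1 one

theorem tensorAlgebra_right_induction {P : TensorAlgebra K V → Prop} (one : P 1)
    (add : ∀ s t, P s → P t → P (s + t)) (smul : ∀ (c : K) t, P t → P (c • t))
    (mul_ι : ∀ t v, P t → P (t * TensorAlgebra.ι K v)) (t : TensorAlgebra K V) : P t := by
  have h : ∀ a t, P t → P (t * a) := by
    intro a
    induction a using TensorAlgebra.induction with
    | algebraMap c =>
      intro t ht; rw [← Algebra.commutes, ← Algebra.smul_def]; exact smul c t ht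
    | ι v => exact fun t => mul_ι t v
    | mul a b ha hb => intro t ht; rw [← mul_assoc]; exact hb _ (ha t ht)
    | add a b ha hb => intro t ht; rw [mul_add]; exact add _ _ (ha t ht) (hb t ht)
  simpa using h t 1 one

/-- A linear map `B` from `V` to the operators on `N` makes `N` a right module for the tensor
algebra; `rightAct B t` is the operator `n ↦ n · t`. -/
def rightAct (B : V →ₗ[K] Module.End K N) : TensorAlgebra K V →ₗ[K] Module.End K N :=
  (MulOpposite.opLinearEquiv K).symm.toLinearMap ∘ₗ
    (TensorAlgebra.lift K ((MulOpposite.opLinearEquiv K).toLinearMap ∘ₗ B)).toLinearMap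

@[simp]
theorem rightAct_one (B : V →ₗ[K] Module.End K N) (n : N) : rightAct B 1 n = n := by
  simp [rightAct]

@[simp]
theorem rightAct_ι (B : V →ₗ[K] Module.End K N) (v : V) (n : N) :
    rightAct B (TensorAlgebra.ι K v) n = B v n := by
  simp [rightAct]

theorem rightAct_mul (B : V →ₗ[K] Module.End K N) (s t : TensorAlgebra K V) (n : N) :
    rightAct B (s * t) n = rightAct B t (rightAct B s n) := by
  simp [rightAct]

/-- The linear map on the tensor algebra with `1 ↦ 0` and `v * t ↦ G v t` for `v ∈ V`. -/
def headMap (G : V →ₗ[K] TensorAlgebra K V →ₗ[K] N) : TensorAlgebra K V →ₗ[K] N :=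
  LinearMap.snd K (TensorAlgebra K V) N ∘ₗ LinearMap.applyₗ (1, 0) ∘ₗ
    (TensorAlgebra.lift K (LinearMap.mk₂ K
      (fun (v : V) (z : TensorAlgebra K V × N) => (TensorAlgebra.ι K v * z.1, G v z.1))
      (fun v w z => by simp [add_mul]) (fun c v z => by simp) (fun v z w => by simp [mul_add])
      (fun c v z => by simp) : V →ₗ[K] Module.End K (TensorAlgebra K V × N))).toLinearMap

@[simp]
theorem headMap_one (G : V →ₗ[K] TensorAlgebra K V →ₗ[K] N) : headMap G 1 = 0 := by
  simp [headMap]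

-- The first coordinate of the state in `T(V) × N` records the tensor read so far. In a product the
-- left factor acts last, so `v` meets the state whose first coordinate is `t`.
@[simp]
theorem headMap_ι_mul (G : V →ₗ[K] TensorAlgebra K V →ₗ[K] N) (v : V) (t : TensorAlgebra K V) :
    headMap G (TensorAlgebra.ι K v * t) = G v t := by
  have h : ∀ t : TensorAlgebra K V, (TensorAlgebra.lift K (LinearMap.mk₂ K
      (fun (v : V) (z : TensorAlgebra K V × N) => (TensorAlgebra.ι K v * z.1, G v z.1))
      (fun v w z => by simp [add_mul]) (fun c v z => by simp) (fun v z w => by simp [mul_add])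
      (fun c v z => by simp) : V →ₗ[K] Module.End K (TensorAlgebra K V × N)) t (1, 0)).1 = t := by
    intro t
    induction t using tensorAlgebra_left_induction with
    | one => simp
    | add s t hs ht => simp [hs, ht]
    | smul c t ht => simp [ht]
    | ι_mul v t ht => simp [ht]
  simp [headMap, h]

/-- The algebra homomorphism `T(V) → T(V) ⊕ ε T(V)` with `v ↦ v + ε g(v)`. -/
def tensorDerAux (g : V →ₗ[K] TensorAlgebra K V) : TensorAlgebra K V →ₐ[K]
    TrivSqZeroExt (TensorAlgebra K V) (TensorAlgebra K V) :=
  TensorAlgebra.lift K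
    { toFun := fun v => TrivSqZeroExt.inl (TensorAlgebra.ι K v) + TrivSqZeroExt.inr (g v)
      map_add' := fun a b => by ext <;> simp
      map_smul' := fun c a => by ext <;> simp }

theorem tensorDerAux_fst (g : V →ₗ[K] TensorAlgebra K V) (t : TensorAlgebra K V) :
    (tensorDerAux g t).fst = t := by
  induction t using tensorAlgebra_left_induction with
  | one => simp
  | add s t hs ht => simp [hs, ht]
  | smul c t ht => simp [ht]
  | ι_mul v t ht => simp [ht]; simp [tensorDerAux]

theorem tensorDerAux_snd_mul (g : V →ₗ[K] TensorAlgebra K V) (s t : TensorAlgebra K V) :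
    (tensorDerAux g (s * t)).snd = (tensorDerAux g s).snd * t + s * (tensorDerAux g t).snd := by
  simp [TrivSqZeroExt.snd_mul, tensorDerAux_fst, add_comm]

theorem tensorDerAux_snd_ι (g : V →ₗ[K] TensorAlgebra K V) (v : V) :
    (tensorDerAux g (TensorAlgebra.ι K v)).snd = g v := by
  simp [tensorDerAux]

theorem tensorDerAux_snd_one (g : V →ₗ[K] TensorAlgebra K V) :
    (tensorDerAux g 1).snd = 0 := by
  simp

/-- The derivation of the tensor algebra that extends a linear map `g : V → T(V)`. -/
def algDer : (V →ₗ[K] TensorAlgebra K V) →ₗ[K] Module.End K (TensorAlgebra K V) :=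
  LinearMap.mk₂ K (fun g t => (tensorDerAux g t).snd)
    (fun g h t => by
      induction t using tensorAlgebra_left_induction with
      | one => simp
      | add s t hs ht => simp only [map_add, TrivSqZeroExt.snd_add, hs, ht]; abel
      | smul c t ht => simp [ht]
      | ι_mul v t ht =>
        simp only [tensorDerAux_snd_mul, tensorDerAux_snd_ι, ht, LinearMap.add_apply, add_mul,
          mul_add]
        abel)
    (fun c g t => by
      induction t using tensorAlgebra_left_induction with
      | one => simp
      | add s t hs ht => simp only [map_add, TrivSqZeroExt.snd_add, hs, ht, smul_add]
      | smul d t ht => simp only [map_smul, TrivSqZeroExt.snd_smul, ht, smul_comm c d]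
      | ι_mul v t ht =>
        simp only [tensorDerAux_snd_mul, tensorDerAux_snd_ι, ht, LinearMap.smul_apply, smul_add,
          smul_mul_assoc, mul_smul_comm])
    (fun g s t => by simp) (fun c g t => by simp)

@[simp]
theorem algDer_one (g : V →ₗ[K] TensorAlgebra K V) : algDer g 1 = 0 := tensorDerAux_snd_one g

@[simp]
theorem algDer_ι (g : V →ₗ[K] TensorAlgebra K V) (v : V) :
    algDer g (TensorAlgebra.ι K v) = g v := tensorDerAux_snd_ι g v

theorem algDer_mul (g : V →ₗ[K] TensorAlgebra K V) (s t : TensorAlgebra K V) :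
    algDer g (s * t) = algDer g s * t + s * algDer g t := tensorDerAux_snd_mul g s t

/-- A commutator of derivations is a derivation, so the identity only has to be checked on `V`. -/
theorem algDer_commutator (g h k : V →ₗ[K] TensorAlgebra K V)
    (H : ∀ v, algDer g (h v) = k v + algDer h (g v)) (t : TensorAlgebra K V) :
    algDer g (algDer h t) = algDer k t + algDer h (algDer g t) := by
  induction t using tensorAlgebra_left_induction with
  | one => simp
  | add s t hs ht => simp only [map_add, hs, ht]; abel
  | smul c t ht => simp [ht]
  | ι_mul v t ht =>
    simp only [algDer_mul, algDer_ι, map_add, H, ht, mul_add, add_mul]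
    abel

/-- Right multiplication by `b ∈ V`, on elements of `V`. -/
def mulGen : V →ₗ[K] V →ₗ[K] TensorAlgebra K V :=
  LinearMap.mk₂ K (fun b y => TensorAlgebra.ι K y * TensorAlgebra.ι K b)
    (fun _ _ _ => by simp [mul_add]) (fun _ _ _ => by simp) (fun _ _ _ => by simp [add_mul])
    (fun _ _ _ => by simp)

@[simp]
theorem mulGen_apply (b y : V) :
    mulGen b y = TensorAlgebra.ι K y * TensorAlgebra.ι K b := rfl

/-- The derivation of the tensor algebra with `y ↦ y * b` for `y ∈ V`: it inserts `b` after each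
letter of a word. -/
def insertAfter : V →ₗ[K] Module.End K (TensorAlgebra K V) := algDer ∘ₗ mulGen

@[simp]
theorem insertAfter_one (b : V) : insertAfter (K := K) b 1 = 0 := algDer_one _

@[simp]
theorem insertAfter_ι (b y : V) : insertAfter (K := K) b (TensorAlgebra.ι K y) =
    TensorAlgebra.ι K y * TensorAlgebra.ι K b := by
  simp [insertAfter]

theorem insertAfter_mul (b : V) (s t : TensorAlgebra K V) :
    insertAfter b (s * t) = insertAfter b s * t + s * insertAfter b t := algDer_mul _ s t

/-- On a letter y both composites give ybc + ycb. This commutation is what later removes the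
insertion terms for elements of L'. -/
theorem insertAfter_comm (b c : V) (t : TensorAlgebra K V) :
    insertAfter b (insertAfter c t) = insertAfter c (insertAfter b t) := by
  have := algDer_commutator (K := K) (mulGen b) (mulGen c) 0 (fun v => by
    simp only [mulGen_apply, algDer_mul, algDer_ι, LinearMap.zero_apply, mul_assoc, zero_add]
    rw [add_comm]) t
  rwa [map_zero, LinearMap.zero_apply, zero_add] at this

theorem algDer_insertAfter (f : Module.End K V) (b : V) (t : TensorAlgebra K V) :
    algDer (TensorAlgebra.ι K ∘ₗ f) (insertAfter b t) =
      insertAfter (f b) t + insertAfter b (algDer (TensorAlgebra.ι K ∘ₗ f) t) :=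
  algDer_commutator (K := K) _ (mulGen b) (mulGen (f b)) (fun v => by
    simp only [mulGen_apply, LinearMap.comp_apply, algDer_mul, algDer_ι, add_comm]) t

/-- The product in the tensor algebra of a list of elements of `V`. -/
def word (K : Type*) {V : Type*} [CommRing K] [AddCommGroup V] [Module K V] (l : List V) :
    TensorAlgebra K V :=
  (l.map (TensorAlgebra.ι K)).prod

@[simp] theorem word_nil : word K ([] : List V) = 1 := rfl

@[simp] theorem word_cons (a : V) (l : List V) :
    word K (a :: l) = TensorAlgebra.ι K a * word K l := by simp [word]

@[simp] theorem word_append (l m : List V) : word K (l ++ m) = word K l * word K m := by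
  simp [word]

variable (K V) in
/-- The homogeneous component of degree `n` of the tensor algebra. -/
def words (n : ℕ) : Submodule K (TensorAlgebra K V) :=
  Submodule.span K {t | ∃ l : List V, l.length = n ∧ t = word K l}

theorem word_mem (l : List V) : word K l ∈ words K V l.length :=
  Submodule.subset_span ⟨l, rfl, rfl⟩

theorem one_mem_words : (1 : TensorAlgebra K V) ∈ words K V 0 := word_mem []

theorem ι_mem_words (v : V) : TensorAlgebra.ι K v ∈ words K V 1 := by
  simpa using word_mem (K := K) [v]

theorem mul_mem_words {m n : ℕ} {s t : TensorAlgebra K V} (hs : s ∈ words K V m)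
    (ht : t ∈ words K V n) : s * t ∈ words K V (m + n) := by
  induction hs using Submodule.span_induction with
  | zero => simp
  | add x y _ _ hx hy => rw [add_mul]; exact add_mem hx hy
  | smul c x _ hx => rw [smul_mul_assoc]; exact Submodule.smul_mem _ c hx
  | mem s hs =>
  obtain ⟨l, rfl, rfl⟩ := hs
  induction ht using Submodule.span_induction with
  | zero => simp
  | add x y _ _ hx hy => rw [mul_add]; exact add_mem hx hy
  | smul c x _ hx => rw [mul_smul_comm]; exact Submodule.smul_mem _ c hx
  | mem t ht =>
  obtain ⟨l', rfl, rfl⟩ := ht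
  rw [← word_append, ← List.length_append]
  exact word_mem _

theorem insertAfter_mem_words {n : ℕ} {t : TensorAlgebra K V} (ht : t ∈ words K V n) (b : V) :
    insertAfter b t ∈ words K V (n + 1) := by
  induction ht using Submodule.span_induction with
  | zero => simp
  | add x y _ _ hx hy => rw [map_add]; exact add_mem hx hy
  | smul c x _ hx => rw [map_smul]; exact Submodule.smul_mem _ c hx
  | mem s hs =>
    obtain ⟨l, rfl, rfl⟩ := hs
    induction l with
    | nil => simp
    | cons a l ih =>
      rw [word_cons, insertAfter_mul, insertAfter_ι, List.length_cons]
      refine add_mem ?_ ?_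
      · rw [mul_assoc, add_comm, add_comm l.length 1]
        exact mul_mem_words (ι_mem_words a) (mul_mem_words (ι_mem_words b) (word_mem l))
      · rw [add_assoc, add_comm l.length]
        have := mul_mem_words (ι_mem_words a) ih
        convert this using 2; ring

/-- The degree zero part of an element of the tensor algebra. -/
def counit : TensorAlgebra K V →ₐ[K] K := TensorAlgebra.algebraMapInv

@[simp] theorem counit_ι (v : V) : counit (TensorAlgebra.ι K v) = 0 := by
  simp [counit, TensorAlgebra.algebraMapInv]

end TensorAlgebraTools

/-! ### The right adjoint action and the canonical map to the tensor algebra -/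

section Adjoint

variable {K V L : Type*} [CommRing K] [AddCommGroup V] [Module K V] [LieRing L] [LieAlgebra K L]

/-- For a linear map `j : V → L`, the operators `u ↦ ⁅u, j v⁆` on `L`. -/
def adR (j : V →ₗ[K] L) : V →ₗ[K] Module.End K L :=
  LinearMap.mk₂ K (fun v u => ⁅u, j v⁆) (fun _ _ _ => by simp) (fun _ _ _ => by simp)
    (fun _ _ _ => by simp) (fun _ _ _ => by simp)

@[simp]
theorem adR_apply (j : V →ₗ[K] L) (v : V) (u : L) : adR j v u = ⁅u, j v⁆ := rfl

theorem map_rightAct_adR {M : Type*} [LieRing M] [LieAlgebra K M] (π : L →ₗ⁅K⁆ M)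
    (j : V →ₗ[K] L) (t : TensorAlgebra K V) (u : L) :
    π (rightAct (adR j) t u) = rightAct (adR ((π : L →ₗ[K] M) ∘ₗ j)) t (π u) := by
  induction t using tensorAlgebra_right_induction generalizing u with
  | one => simp
  | add s t hs ht => simp [hs, ht]
  | smul c t ht => simp [ht]
  | mul_ι t v ht => simp [rightAct_mul, ht]

variable (K V) in
/-- The canonical map from the free Lie algebra to the tensor algebra. -/
def toAlg : FreeLie K V →ₗ[K] TensorAlgebra K V :=
  TensorAlgebra.ofDirectSum.toLinearMap ∘ₗ toTensors K V

@[simp]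
theorem toAlg_ι (v : V) : toAlg K V (FreeLie.ι K v) = TensorAlgebra.ι K v := by
  simp only [toAlg, LinearMap.comp_apply, toTensors_ι, AlgHom.toLinearMap_apply]
  rw [TensorAlgebra.ofDirectSum_of_tprod, TensorAlgebra.tprod_apply]
  simp

theorem toAlg_lie (u w : FreeLie K V) : toAlg K V ⁅u, w⁆ =
    toAlg K V u * toAlg K V w - toAlg K V w * toAlg K V u := by
  simp [toAlg, toTensors_lie]

theorem toDirectSum_toAlg (u : FreeLie K V) :
    TensorAlgebra.toDirectSum (toAlg K V u) = toTensors K V u := by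
  simp [toAlg, TensorAlgebra.toDirectSum_ofDirectSum]

@[simp]
theorem counit_toAlg (u : FreeLie K V) : counit (toAlg K V u) = 0 := by
  induction u using FreeLie.induction with
  | hι v => simp
  | h0 => simp
  | hadd x y hx hy => simp [hx, hy]
  | hsmul c x hx => simp [hx]
  | hlie x y hx hy => simp [toAlg_lie, hx, hy]

variable (K V) in
/-- The right adjoint action of the tensor algebra on the free Lie algebra. -/
def lieAct : TensorAlgebra K V →ₗ[K] Module.End K (FreeLie K V) :=
  rightAct (adR (FreeLie.ι K))

@[simp]
theorem lieAct_one (u : FreeLie K V) : lieAct K V 1 u = u := rightAct_one _ _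

@[simp]
theorem lieAct_ι (v : V) (u : FreeLie K V) :
    lieAct K V (TensorAlgebra.ι K v) u = ⁅u, FreeLie.ι K v⁆ := rightAct_ι _ _ _

theorem lieAct_mul (s t : TensorAlgebra K V) (u : FreeLie K V) :
    lieAct K V (s * t) u = lieAct K V t (lieAct K V s u) := rightAct_mul _ _ _ _

/-- By the Jacobi identity the right adjoint action of a commutator is the commutator of the
actions, so the action of T(V) restricts to the adjoint action of L(V). -/
theorem lieAct_toAlg (w u : FreeLie K V) : lieAct K V (toAlg K V w) u = ⁅u, w⁆ := by
  induction w using FreeLie.induction generalizing u with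
  | hι v => simp
  | h0 => simp
  | hadd x y hx hy => simp [hx, hy]
  | hsmul c x hx => simp [hx]
  | hlie x y hx hy =>
    simp only [toAlg_lie, map_sub, LinearMap.sub_apply, lieAct_mul, hx, hy]
    rw [leibniz_lie u x y, ← lie_skew x ⁅u, y⁆]
    abel

theorem lieDer_lieAct (f : Module.End K V) (t : TensorAlgebra K V) (u : FreeLie K V) :
    lieDer f (lieAct K V t u) =
      lieAct K V (algDer (TensorAlgebra.ι K ∘ₗ f) t) u + lieAct K V t (lieDer f u) := by
  induction t using tensorAlgebra_right_induction generalizing u with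
  | one => simp
  | add s t hs ht => simp only [map_add, LinearMap.add_apply, hs, ht]; abel
  | smul c t ht => simp [ht]
  | mul_ι t v ht =>
    simp only [lieAct_mul, lieAct_ι, algDer_mul, algDer_ι, LieDerivation.apply_lie_eq_add, ht,
      lieDer_ι, map_add, LinearMap.add_apply, add_lie, LinearMap.comp_apply]
    abel

theorem headMap_mul_toAlg (G : V →ₗ[K] TensorAlgebra K V →ₗ[K] FreeLie K V) (w : FreeLie K V)
    (h : ∀ v t, G v (t * toAlg K V w) = ⁅G v t, w⁆) (s : TensorAlgebra K V) :
    headMap G (s * toAlg K V w) =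
      ⁅headMap G s, w⁆ + counit s • headMap G (toAlg K V w) := by
  induction s using tensorAlgebra_left_induction with
  | one => simp
  | add s t hs ht => simp only [add_mul, map_add, hs, ht, add_lie, add_smul]; abel
  | smul c t ht => simp [ht, mul_smul]
  | ι_mul v t ht => simp [mul_assoc, h]

/-- Lie elements have no constant term, so in uw - wu the first letter always comes from the left
factor, and by hypothesis the right factor comes out as a bracket. -/
theorem headMap_toAlg_lie (G : V →ₗ[K] TensorAlgebra K V →ₗ[K] FreeLie K V) (u w : FreeLie K V)
    (hu : ∀ v t, G v (t * toAlg K V u) = ⁅G v t, u⁆)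
    (hw : ∀ v t, G v (t * toAlg K V w) = ⁅G v t, w⁆) :
    headMap G (toAlg K V ⁅u, w⁆) = ⁅headMap G (toAlg K V u), w⁆ + ⁅u, headMap G (toAlg K V w)⁆ := by
  rw [toAlg_lie, map_sub, headMap_mul_toAlg G w hw, headMap_mul_toAlg G u hu, counit_toAlg,
    counit_toAlg, ← lie_skew u]
  simp [sub_eq_add_neg]

/-- The linear map `T(V) → L(V)` with `a₁ ⊗ ⋯ ⊗ aₙ ↦ [f a₁, a₂, …, aₙ]`. -/
def bracketing (f : Module.End K V) : TensorAlgebra K V →ₗ[K] FreeLie K V :=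
  headMap ((lieAct K V).flip ∘ₗ FreeLie.ι K ∘ₗ f)

/-- For `f = id` this is the Dynkin–Specht–Wever identity. Its use here is that the derivation
`lieDer f` factors through the image in T(V). -/
theorem bracketing_toAlg (f : Module.End K V) (u : FreeLie K V) :
    bracketing f (toAlg K V u) = lieDer f u := by
  induction u using FreeLie.induction with
  | hι v =>
    rw [toAlg_ι, lieDer_ι, ← mul_one (TensorAlgebra.ι K v), bracketing, headMap_ι_mul]
    simp
  | h0 => simp
  | hadd x y hx hy => simp [hx, hy]
  | hsmul c x hx => simp [hx]
  | hlie x y hx hy =>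
    have h : ∀ (w : FreeLie K V) v t, ((lieAct K V).flip ∘ₗ FreeLie.ι K ∘ₗ f) v
        (t * toAlg K V w) = ⁅((lieAct K V).flip ∘ₗ FreeLie.ι K ∘ₗ f) v t, w⁆ := by
      intro w v t
      simp [lieAct_mul, lieAct_toAlg]
    rw [bracketing, headMap_toAlg_lie _ _ _ (h x) (h y), LieDerivation.apply_lie_eq_add, add_comm,
      ← hx, ← hy, bracketing]

theorem lieDer_eq_zero_of_toAlg_eq_zero {u : FreeLie K V} (h : toAlg K V u = 0)
    (f : Module.End K V) : lieDer f u = 0 := by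
  rw [← bracketing_toAlg, h, map_zero]

theorem leftNormed_append_singleton (a : V) (l : List V) (b : V) :
    leftNormed K a (l ++ [b]) = ⁅leftNormed K a l, FreeLie.ι K b⁆ := by
  simp [leftNormed]

theorem leftNormed_eq_lieAct (a : V) (l : List V) :
    leftNormed K a l = lieAct K V (word K l) (FreeLie.ι K a) := by
  induction l using List.reverseRecOn with
  | nil => simp [leftNormed]
  | append_singleton l b ih => simp [leftNormed_append_singleton, ih, lieAct_mul]

theorem toAlg_mem_words {n : ℕ} {u : FreeLie K V} (hu : u ∈ liePowerSpan K V n) :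
    toAlg K V u ∈ words K V n := by
  induction hu using Submodule.span_induction with
  | zero => simp
  | add x y _ _ hx hy => rw [map_add]; exact add_mem hx hy
  | smul c x _ hx => rw [map_smul]; exact Submodule.smul_mem _ c hx
  | mem u hu =>
    obtain ⟨a, l, rfl, rfl⟩ := hu
    induction l using List.reverseRecOn with
    | nil => simpa [leftNormed] using ι_mem_words a
    | append_singleton l b ih =>
      rw [leftNormed_append_singleton, toAlg_lie, toAlg_ι, List.length_append,
        List.length_singleton]
      refine sub_mem (mul_mem_words ih (ι_mem_words b)) ?_
      rw [add_comm]
      exact mul_mem_words (ι_mem_words b) ih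

theorem toDirectSum_word (l : List V) : TensorAlgebra.toDirectSum (word K l) =
    DirectSum.of (fun n => ⨂[K]^n V) l.length (PiTensorProduct.tprod K l.get) := by
  rw [← TensorAlgebra.toDirectSum_tensorPower_tprod, TensorAlgebra.tprod_apply, word]
  congr 2
  rw [← List.ofFn_get l]
  simp [List.ofFn_get]

theorem toDirectSum_words {n : ℕ} {t : TensorAlgebra K V} (ht : t ∈ words K V n) :
    ∃ y : ⨂[K]^n V, TensorAlgebra.toDirectSum t = DirectSum.of (fun n => ⨂[K]^n V) n y := by
  induction ht using Submodule.span_induction with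
  | zero => exact ⟨0, by simp⟩
  | add x y _ _ hx hy =>
    obtain ⟨x', hx⟩ := hx
    obtain ⟨y', hy⟩ := hy
    exact ⟨x' + y', by rw [map_add, hx, hy, map_add]⟩
  | smul c x _ hx =>
    obtain ⟨x', hx⟩ := hx
    refine ⟨c • x', ?_⟩
    rw [map_smul, hx]
    exact ((DirectSum.lof K ℕ (fun n => ⨂[K]^n V) n).map_smul c x').symm
  | mem t ht =>
    obtain ⟨l, rfl, rfl⟩ := ht
    exact ⟨_, toDirectSum_word l⟩

end Adjoint

/-! ### Injectivity of the canonical map in degrees at most `p` -/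

section Injectivity

variable {K V : Type*} [Field K] [AddCommGroup V] [Module K V] {I : Type*}

theorem leftNormed_replicate_self (a : V) {m : ℕ} (hm : m ≠ 0) :
    leftNormed K a (List.replicate m a) = 0 := by
  obtain ⟨m, rfl⟩ := Nat.exists_eq_succ_of_ne_zero hm
  rw [List.replicate_succ, leftNormed_eq_lieAct, word_cons, lieAct_mul, lieAct_ι, lie_self,
    map_zero]

/-- The projection of `V` to the line spanned by a basis vector. -/
def lineProj (b : Module.Basis I K V) (a : I) : Module.End K V := (b.coord a).smulRight (b a)

theorem lineProj_basis [DecidableEq I] (b : Module.Basis I K V) (a i : I) :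
    lineProj b a (b i) = if i = a then b a else 0 := by
  simp [lineProj, Finsupp.single_apply]

theorem lieDer_lineProj_leftNormed [DecidableEq I] (b : Module.Basis I K V) (a i : I)
    (l : List I) : lieDer (lineProj b a) (leftNormed K (b i) (l.map b)) =
      ((i :: l).count a : K) • leftNormed K (b i) (l.map b) := by
  induction l using List.reverseRecOn with
  | nil =>
    simp only [List.map_nil, leftNormed, List.foldl_nil, lieDer_ι, lineProj_basis]
    by_cases h : i = a
    · subst h; simp
    · simp [h]
  | append_singleton l c ih =>
    have h : lieDer (lineProj b a) (FreeLie.ι K (b c)) =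
        (([c] : List I).count a : K) • FreeLie.ι K (b c) := by
      rw [lieDer_ι, lineProj_basis]
      by_cases h : c = a
      · subst h; simp
      · simp [h]
    rw [List.map_append, List.map_singleton, leftNormed_append_singleton,
      LieDerivation.apply_lie_eq_add, ih, h, ← List.cons_append, List.count_append]
    simp only [lie_smul, smul_lie, Nat.cast_add, add_smul]
    rw [add_comm]

/-- Left-normed products of `n` basis vectors with indices in `S`, in which each index in `S'`
occurs with a multiplicity that is divisible by `p`. -/
def monomialSpan [DecidableEq I] (b : Module.Basis I K V) (p n : ℕ) (S S' : Finset I) :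
    Submodule K (FreeLie K V) :=
  Submodule.span K {u | ∃ i l, l.length + 1 = n ∧ (∀ a ∈ i :: l, a ∈ S) ∧
    (∀ a ∈ S', p ∣ (i :: l).count a) ∧ u = leftNormed K (b i) (l.map b)}

theorem monomialSpan_mono [DecidableEq I] (b : Module.Basis I K V) (p n : ℕ) {S T : Finset I}
    (h : S ⊆ T) : monomialSpan b p n S ∅ ≤ monomialSpan b p n T ∅ := by
  refine Submodule.span_mono ?_
  rintro _ ⟨i, l, hl, hS, -, rfl⟩
  exact ⟨i, l, hl, fun a ha => h (hS a ha), by simp, rfl⟩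

theorem lie_basis_mem_monomialSpan [DecidableEq I] (b : Module.Basis I K V) (p : ℕ) {n : ℕ}
    {S : Finset I} {u : FreeLie K V} (hu : u ∈ monomialSpan b p n S ∅) (c : I) :
    ⁅u, FreeLie.ι K (b c)⁆ ∈ monomialSpan b p (n + 1) (insert c S) ∅ := by
  induction hu using Submodule.span_induction with
  | zero => simp
  | add x y _ _ hx hy => rw [add_lie]; exact add_mem hx hy
  | smul c x _ hx => rw [smul_lie]; exact Submodule.smul_mem _ _ hx
  | mem u hu =>
    obtain ⟨i, l, hl, hS, -, rfl⟩ := hu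
    refine Submodule.subset_span ⟨i, l ++ [c], by simp [hl], ?_, by simp, ?_⟩
    · intro a ha
      rw [← List.cons_append, List.mem_append, List.mem_singleton] at ha
      rcases ha with ha | rfl
      · exact Finset.mem_insert_of_mem (hS a ha)
      · exact Finset.mem_insert_self _ _
    · rw [List.map_append, List.map_singleton, leftNormed_append_singleton]

theorem exists_mem_monomialSpan_add [DecidableEq I] (b : Module.Basis I K V) (p n : ℕ)
    {x y : FreeLie K V} (hx : ∃ S, x ∈ monomialSpan b p n S ∅)
    (hy : ∃ S, y ∈ monomialSpan b p n S ∅) : ∃ S, x + y ∈ monomialSpan b p n S ∅ := by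
  obtain ⟨S, hS⟩ := hx
  obtain ⟨T, hT⟩ := hy
  exact ⟨S ∪ T, add_mem (monomialSpan_mono b p n Finset.subset_union_left hS)
    (monomialSpan_mono b p n Finset.subset_union_right hT)⟩

theorem exists_mem_monomialSpan [DecidableEq I] (b : Module.Basis I K V) (p : ℕ) {n : ℕ}
    {u : FreeLie K V} (hu : u ∈ liePowerSpan K V n) :
    ∃ S, u ∈ monomialSpan b p n S ∅ := by
  induction hu using Submodule.span_induction with
  | zero => exact ⟨∅, zero_mem _⟩
  | add x y _ _ hx hy => exact exists_mem_monomialSpan_add b p n hx hy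
  | smul c x _ hx =>
    obtain ⟨S, hS⟩ := hx
    exact ⟨S, Submodule.smul_mem _ c hS⟩
  | mem u hu =>
    obtain ⟨a, l, rfl, rfl⟩ := hu
    induction l using List.reverseRecOn with
    | nil =>
      have ha : a ∈ Submodule.span K (Set.range b) := by rw [b.span_eq]; trivial
      induction ha using Submodule.span_induction with
      | zero => exact ⟨∅, by simp [leftNormed]⟩
      | add x y _ _ hx hy =>
        simpa [leftNormed] using exists_mem_monomialSpan_add b p _ hx hy
      | smul c x _ hx =>
        obtain ⟨S, hS⟩ := hx
        exact ⟨S, by simpa [leftNormed] using Submodule.smul_mem _ c hS⟩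
      | mem a ha =>
        obtain ⟨i, rfl⟩ := ha
        exact ⟨{i}, Submodule.subset_span ⟨i, [], rfl, by simp, by simp, rfl⟩⟩
    | append_singleton l c ih =>
      rw [leftNormed_append_singleton, List.length_append, List.length_singleton]
      have hc : c ∈ Submodule.span K (Set.range b) := by rw [b.span_eq]; trivial
      induction hc using Submodule.span_induction with
      | zero => exact ⟨∅, by simp⟩
      | add x y _ _ hx hy =>
        rw [map_add, lie_add]
        exact exists_mem_monomialSpan_add b p _ hx hy
      | smul c x _ hx =>
        obtain ⟨S, hS⟩ := hx
        exact ⟨S, by rw [map_smul, lie_smul]; exact Submodule.smul_mem _ c hS⟩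
      | mem a ha =>
        obtain ⟨i, rfl⟩ := ha
        obtain ⟨S, hS⟩ := ih
        exact ⟨_, lie_basis_mem_monomialSpan b p hS i⟩

variable {p : ℕ}

/-- Left-normed monomials are eigenvectors of the derivation δ, the eigenvalue being the
multiplicity of the letter `a`. By Fermat, 1 - δ^(p-1) keeps the monomials whose multiplicity is
divisible by `p` and kills the others; it fixes `u` because δu = 0. -/
theorem mem_monomialSpan_insert [CharP K p] (hp : p.Prime) [DecidableEq I] (b : Module.Basis I K V) {n : ℕ}
    {S S' : Finset I} {u : FreeLie K V} (hu : u ∈ monomialSpan b p n S S') (a : I)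
    (ha : lieDer (lineProj b a) u = 0) : u ∈ monomialSpan b p n S (insert a S') := by
  have : Fact p.Prime := ⟨hp⟩
  set δ : Module.End K (FreeLie K V) := (lieDer (lineProj b a)).toLinearMap
  have hδ : u - (δ ^ (p - 1)) u = u := by
    have h1 : p - 1 = (p - 2) + 1 := by have := hp.two_le; omega
    rw [h1, pow_succ, Module.End.mul_apply]
    change u - (δ ^ (p - 2)) (lieDer (lineProj b a) u) = u
    rw [ha, map_zero, sub_zero]
  rw [← hδ]
  clear hδ ha
  induction hu using Submodule.span_induction with
  | zero => simp
  | add x y _ _ hx hy =>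
    rw [map_add, add_sub_add_comm]
    exact add_mem hx hy
  | smul c x _ hx =>
    rw [map_smul, ← smul_sub]
    exact Submodule.smul_mem _ c hx
  | mem u hu =>
    obtain ⟨i, l, hl, hS, hS', rfl⟩ := hu
    have h : ∀ k, (δ ^ k) (leftNormed K (b i) (l.map b)) =
        ((i :: l).count a : K) ^ k • leftNormed K (b i) (l.map b) := by
      intro k
      induction k with
      | zero => simp
      | succ k ih =>
        rw [pow_succ, Module.End.mul_apply]
        change (δ ^ k) (lieDer (lineProj b a) _) = _
        rw [lieDer_lineProj_leftNormed, map_smul, ih, smul_smul, pow_succ']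
    rw [h]
    by_cases hd : p ∣ (i :: l).count a
    · rw [(CharP.cast_eq_zero_iff K p _).2 hd, zero_pow (by have := hp.two_le; omega), zero_smul,
        sub_zero]
      refine Submodule.subset_span ⟨i, l, hl, hS, ?_, rfl⟩
      intro c hc
      rcases Finset.mem_insert.1 hc with rfl | hc
      · exact hd
      · exact hS' c hc
    · have h1 : ((i :: l).count a : K) ^ (p - 1) = 1 := by
        have h2 : (((i :: l).count a : ℕ) : ZMod p) ≠ 0 := by
          rwa [Ne, ZMod.natCast_eq_zero_iff]
        have h3 := congrArg (ZMod.castHom (dvd_refl p) K) (ZMod.pow_card_sub_one_eq_one h2)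
        simpa using h3
      rw [h1, one_smul, sub_self]
      exact zero_mem _

/-- The multiplicity of the first letter is a positive multiple of `p`, and there are at most `p`
letters, so all letters coincide and the product begins with [a, a]. -/
theorem monomialSpan_self (hp : p.Prime) [DecidableEq I] (b : Module.Basis I K V) {n : ℕ}
    (hn : n ≤ p) (S : Finset I) : monomialSpan b p n S S = ⊥ := by
  rw [monomialSpan, Submodule.span_eq_bot]
  rintro _ ⟨i, l, hl, hS, hS', rfl⟩
  have h1 : p ∣ (i :: l).count i := hS' i (hS i (by simp))
  have h2 : (i :: l).count i ≤ (i :: l).length := List.count_le_length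
  have h3 : p ≤ (i :: l).count i := Nat.le_of_dvd (by simp) h1
  have h4 : (i :: l).count i = (i :: l).length := by
    rw [List.length_cons] at h2 ⊢
    omega
  have h5 : l = List.replicate l.length i :=
    List.eq_replicate_iff.2 ⟨rfl, fun c hc => ((List.count_eq_length.1 h4) c (by simp [hc])).symm⟩
  rw [h5, List.map_replicate]
  refine leftNormed_replicate_self _ ?_
  rw [List.length_cons] at h2
  have := hp.two_le
  omega

theorem eq_zero_of_toAlg_eq_zero [CharP K p] (hp : p.Prime) {n : ℕ} (hn : n ≤ p) {u : FreeLie K V}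
    (hu : u ∈ liePowerSpan K V n) (h : toAlg K V u = 0) : u = 0 := by
  classical
  let b := Module.Basis.ofVectorSpace K V
  obtain ⟨S, hS⟩ := exists_mem_monomialSpan b p hu
  have key : ∀ S' : Finset _, u ∈ monomialSpan b p n S S' := by
    intro S'
    induction S' using Finset.induction_on with
    | empty => exact hS
    | insert a S' _ ih =>
      exact mem_monomialSpan_insert hp b ih a (lieDer_eq_zero_of_toAlg_eq_zero h _)
  have := key S
  rwa [monomialSpan_self hp b hn, Submodule.mem_bot] at this

variable (K V) in
/-- The degree `n` part of the canonical map from the free Lie algebra to the tensor algebra. -/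
def tensorPart (n : ℕ) : FreeLie K V →ₗ[K] ⨂[K]^n V :=
  DirectSum.component K ℕ (fun n => ⨂[K]^n V) n ∘ₗ toTensors K V

theorem toTensors_eq_of_tensorPart {m : ℕ} {u : FreeLie K V} (hu : u ∈ liePowerSpan K V m) :
    toTensors K V u = DirectSum.of (fun n => ⨂[K]^n V) m (tensorPart K V m u) := by
  obtain ⟨y, hy⟩ := toDirectSum_words (toAlg_mem_words hu)
  rw [toDirectSum_toAlg] at hy
  rw [tensorPart, LinearMap.comp_apply, hy]
  congr 1
  exact (DirectSum.component.lof_self (R := K) (M := fun n => ⨂[K]^n V) m y).symm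

theorem tensorPart_of_ne {m n : ℕ} {u : FreeLie K V} (hu : u ∈ liePowerSpan K V m)
    (h : m ≠ n) : tensorPart K V n u = 0 := by
  rw [tensorPart, LinearMap.comp_apply, toTensors_eq_of_tensorPart hu]
  exact DirectSum.of_eq_of_ne _ _ _ h.symm

theorem ofDirectSum_of (m : ℕ) (t : ⨂[K]^m V) :
    TensorAlgebra.ofDirectSum (DirectSum.of (fun n => ⨂[K]^n V) m t) =
      TensorPower.toTensorAlgebra t := by
  induction t using PiTensorProduct.induction_on with
  | smul_tprod c a =>
    have h : DirectSum.of (fun n => ⨂[K]^n V) m (c • PiTensorProduct.tprod K a) =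
        c • DirectSum.of (fun n => ⨂[K]^n V) m (PiTensorProduct.tprod K a) :=
      (DirectSum.lof K ℕ (fun n => ⨂[K]^n V) m).map_smul c _
    rw [h, map_smul, map_smul, TensorAlgebra.ofDirectSum_of_tprod,
      TensorPower.toTensorAlgebra_tprod]
  | add s t hs ht => rw [map_add, map_add, map_add, hs, ht]

theorem toAlg_eq_of_tensorPart {m : ℕ} {u : FreeLie K V} (hu : u ∈ liePowerSpan K V m) :
    toAlg K V u = TensorPower.toTensorAlgebra (tensorPart K V m u) := by
  rw [toAlg, LinearMap.comp_apply, toTensors_eq_of_tensorPart hu, AlgHom.toLinearMap_apply,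
    ofDirectSum_of]

theorem eq_zero_of_tensorPart_eq_zero [CharP K p] (hp : p.Prime) {n : ℕ} (hn : n ≤ p)
    {u : FreeLie K V} (hu : u ∈ liePowerSpan K V n) (h : tensorPart K V n u = 0) : u = 0 := by
  refine eq_zero_of_toAlg_eq_zero hp hn hu ?_
  rw [toAlg_eq_of_tensorPart hu, h, map_zero]

theorem tensorPart_injOn [CharP K p] (hp : p.Prime) :
    Set.InjOn (tensorPart K V p) (liePowerSpan K V p) := by
  intro u hu w hw h
  rw [← sub_eq_zero]
  refine eq_zero_of_tensorPart_eq_zero hp le_rfl (u := u - w)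
    ((liePowerSpan K V p).sub_mem hu hw) ?_
  rw [map_sub, h, sub_self]

end Injectivity

/-! ### Computations in a metabelian Lie algebra -/

section Metabelian

variable {K V M : Type*} [CommRing K] [AddCommGroup V] [Module K V] [LieRing M] [LieAlgebra K M]
  (j : V →ₗ[K] M)

/-- The iterated product `[m, b₁, …, bₖ]`. -/
def listAct (m : M) (l : List V) : M := l.foldl (fun u b => ⁅u, j b⁆) m

@[simp] theorem listAct_nil (m : M) : listAct j m [] = m := rfl

@[simp] theorem listAct_cons (m : M) (b : V) (l : List V) :
    listAct j m (b :: l) = listAct j ⁅m, j b⁆ l := rfl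

@[simp] theorem listAct_append (m : M) (l l' : List V) :
    listAct j m (l ++ l') = listAct j (listAct j m l) l' := List.foldl_append ..

theorem listAct_append_singleton (m : M) (l : List V) (b : V) :
    listAct j m (l ++ [b]) = ⁅listAct j m l, j b⁆ := by simp

theorem rightAct_word (m : M) (l : List V) : rightAct (adR j) (word K l) m = listAct j m l := by
  induction l generalizing m with
  | nil => simp
  | cons b l ih => simp [rightAct_mul, ih]

@[simp] theorem listAct_add (m m' : M) (l : List V) :
    listAct j (m + m') l = listAct j m l + listAct j m' l := by
  simp only [← rightAct_word, map_add]

@[simp] theorem listAct_smul (c : K) (m : M) (l : List V) :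
    listAct j (c • m) l = c • listAct j m l := by
  simp only [← rightAct_word, map_smul]

@[simp] theorem listAct_zero (l : List V) : listAct j 0 l = 0 := by
  simp only [← rightAct_word, map_zero]

/-- The sum of the products `[x, yᵢ, y₁, …, yᵢ₋₁, yᵢ₊₁, …, yₖ]`. -/
def pairSum (x : M) : List V → M
  | [] => 0
  | c :: l => ⁅pairSum x l, j c⁆ + listAct j ⁅x, j c⁆ l

@[simp] theorem pairSum_nil (x : M) : pairSum j x [] = 0 := rfl

theorem pairSum_cons (x : M) (c : V) (l : List V) :
    pairSum j x (c :: l) = ⁅pairSum j x l, j c⁆ + listAct j ⁅x, j c⁆ l := rfl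

/-- By Jacobi the difference of the two sides is [[a, b], [x, y]], so the adjoint operators commute
on the derived algebra. -/
theorem lie_lie_comm (hM : ∀ a b c d : M, ⁅⁅a, b⁆, ⁅c, d⁆⁆ = 0)
    (a b : M) (x y : M) : ⁅⁅⁅a, b⁆, x⁆, y⁆ = ⁅⁅⁅a, b⁆, y⁆, x⁆ := by
  have h := leibniz_lie ⁅a, b⁆ x y
  rw [hM, ← lie_skew x ⁅⁅a, b⁆, y⁆] at h
  exact (sub_eq_zero.1 (by rw [sub_eq_add_neg]; exact h.symm))

theorem listAct_lie_comm (hM : ∀ a b c d : M, ⁅⁅a, b⁆, ⁅c, d⁆⁆ = 0)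
    (a b : M) (l : List V) (y : M) :
    ⁅listAct j ⁅a, b⁆ l, y⁆ = listAct j ⁅⁅a, b⁆, y⁆ l := by
  induction l generalizing a b with
  | nil => rfl
  | cons c l ih => rw [listAct_cons, ih, listAct_cons, lie_lie_comm hM]

theorem listAct_listAct_comm (hM : ∀ a b c d : M, ⁅⁅a, b⁆, ⁅c, d⁆⁆ = 0)
    (a b : M) (l l' : List V) :
    listAct j (listAct j ⁅a, b⁆ l) l' = listAct j (listAct j ⁅a, b⁆ l') l := by
  induction l' generalizing a b with
  | nil => rfl
  | cons c l' ih => rw [listAct_cons, listAct_lie_comm j hM, ih, listAct_cons]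

theorem pairSum_lie_comm (hM : ∀ a b c d : M, ⁅⁅a, b⁆, ⁅c, d⁆⁆ = 0)
    (x : M) (l : List V) (y z : M) :
    ⁅⁅pairSum j x l, y⁆, z⁆ = ⁅⁅pairSum j x l, z⁆, y⁆ := by
  cases l with
  | nil => simp
  | cons c l =>
    simp only [pairSum_cons, add_lie, listAct_lie_comm j hM]
    rw [lie_lie_comm hM _ _ y z, lie_lie_comm hM x (j c) y z]

theorem listAct_pairSum_lie (hM : ∀ a b c d : M, ⁅⁅a, b⁆, ⁅c, d⁆⁆ = 0)
    (x : M) (l l' : List V) (y : M) :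
    ⁅listAct j (pairSum j x l) l', y⁆ = listAct j ⁅pairSum j x l, y⁆ l' := by
  cases l' with
  | nil => rfl
  | cons c l' =>
    rw [listAct_cons, listAct_cons, listAct_lie_comm j hM, pairSum_lie_comm j hM]

/-- The definition peels letters off the front; letters after the second commute, so peeling from
the end gives the same recursion. -/
theorem pairSum_append_singleton (hM : ∀ a b c d : M, ⁅⁅a, b⁆, ⁅c, d⁆⁆ = 0)
    (x : M) (l : List V) (b : V) :
    pairSum j x (l ++ [b]) = ⁅pairSum j x l, j b⁆ + listAct j ⁅x, j b⁆ l := by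
  induction l with
  | nil => simp [pairSum_cons]
  | cons c l ih =>
    rw [List.cons_append, pairSum_cons, ih, pairSum_cons, listAct_append, listAct_cons,
      listAct_nil, listAct_cons, add_lie, add_lie, pairSum_lie_comm j hM x l (j b),
      listAct_lie_comm j hM, listAct_lie_comm j hM]
    abel

/-- The letter `b` is inserted only after some letter, never in first place, so from each of the `n`
places it can be moved to the end. -/
theorem rightAct_insertAfter (hM : ∀ a b c d : M, ⁅⁅a, b⁆, ⁅c, d⁆⁆ = 0)
    {n : ℕ} {t : TensorAlgebra K V} (ht : t ∈ words K V n) (x : M)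
    (b : V) : rightAct (adR j) (insertAfter b t) x = (n : K) • ⁅rightAct (adR j) t x, j b⁆ := by
  induction ht using Submodule.span_induction with
  | zero => simp
  | add s t _ _ hs ht => simp [hs, ht]
  | smul c t _ ht => simp [ht, smul_comm c]
  | mem t ht =>
    obtain ⟨l, rfl, rfl⟩ := ht
    induction l using List.reverseRecOn with
    | nil => simp
    | append_singleton l y ih =>
      rw [word_append, word_cons, word_nil, mul_one, insertAfter_mul, insertAfter_ι, map_add,
        LinearMap.add_apply, rightAct_mul, ih, rightAct_mul, rightAct_mul, rightAct_mul,
        List.length_append, List.length_singleton, rightAct_word]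
      simp only [rightAct_ι, adR_apply, smul_lie, Nat.cast_add, Nat.cast_one, add_smul, one_smul]
      congr 1
      cases l with
      | nil => simp
      | cons c l => simp only [listAct_cons, listAct_lie_comm j hM, lie_lie_comm hM x (j c) (j b)]

/-- The sum of all the words that result from the letters of a list by permutation. -/
def shuffles (K : Type*) {V : Type*} [CommRing K] [AddCommGroup V] [Module K V] :
    List V → TensorAlgebra K V
  | [] => 1
  | b :: J => TensorAlgebra.ι K b * shuffles K J + insertAfter b (shuffles K J)

theorem shuffles_mem (J : List V) : shuffles K J ∈ words K V J.length := by
  induction J with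
  | nil => exact one_mem_words
  | cons b J ih =>
    refine add_mem ?_ (insertAfter_mem_words ih b)
    rw [List.length_cons, add_comm]
    exact mul_mem_words (ι_mem_words b) ih

theorem rightAct_shuffles (hM : ∀ a b c d : M, ⁅⁅a, b⁆, ⁅c, d⁆⁆ = 0)
    (J : List V) (a b : M) :
    rightAct (adR j) (shuffles K J) ⁅a, b⁆ = (J.length.factorial : K) • listAct j ⁅a, b⁆ J := by
  induction J generalizing a b with
  | nil => simp [shuffles]
  | cons c J ih =>
    rw [shuffles, map_add, LinearMap.add_apply, rightAct_mul,
      rightAct_insertAfter j hM (shuffles_mem J), rightAct_ι, adR_apply, ih, ih, listAct_cons,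
      smul_lie, listAct_lie_comm j hM, smul_smul, ← add_smul, List.length_cons,
      Nat.factorial_succ]
    congr 1
    push_cast
    ring

/-- Only the first letter of a permutation matters when it acts on `x`, and each choice of it occurs
in `J.length.factorial` permutations. The factorial explains the denominator in `symCoeff`. -/
theorem rightAct_shuffles_cons (hM : ∀ a b c d : M, ⁅⁅a, b⁆, ⁅c, d⁆⁆ = 0)
    (J : List V) (c : V) (x : M) :
    rightAct (adR j) (shuffles K (c :: J)) x = (J.length.factorial : K) • pairSum j x (c :: J) := by
  induction J generalizing c x with
  | nil => simp [shuffles, pairSum_cons]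
  | cons b J ih =>
    rw [shuffles, map_add, LinearMap.add_apply, rightAct_mul,
      rightAct_insertAfter j hM (shuffles_mem _), rightAct_ι, adR_apply,
      rightAct_shuffles j hM, ih, pairSum_cons j x c, smul_add, add_comm, smul_lie, smul_smul,
      List.length_cons, Nat.factorial_succ, Nat.cast_mul]

end Metabelian

/-! ### Brackets that are symmetrized over subsets of the letters -/

section SymBracket

variable {K V : Type*} [CommRing K] [AddCommGroup V] [Module K V]

/-- The operators through which the letters of a word act on sequences of linear maps from the
tensor algebra to the free Lie algebra: a letter is either bracketed with the values or inserted
into the argument, and the second option shifts the sequence. -/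
def stateOp : V →ₗ[K] Module.End K (ℕ → TensorAlgebra K V →ₗ[K] FreeLie K V) :=
  LinearMap.mk₂ K (fun v q j => adR (FreeLie.ι K) v ∘ₗ q j + q (j + 1) ∘ₗ insertAfter v)
    (fun _ _ _ => by ext j; simp; abel) (fun _ _ _ => by ext j; simp)
    (fun _ _ _ => by ext j; simp; abel) (fun _ _ _ => by ext j; simp)

theorem stateOp_apply (v : V) (q : ℕ → TensorAlgebra K V →ₗ[K] FreeLie K V) (j : ℕ)
    (s : TensorAlgebra K V) :
    stateOp v q j s = ⁅q j s, FreeLie.ι K v⁆ + q (j + 1) (insertAfter v s) := rfl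

/-- The witness is the linear part of `u`. Insertions commute with each other, so they cancel in
commutators and brackets contribute nothing to it. -/
theorem exists_stateOp_toAlg (u : FreeLie K V) : ∃ v : V, ∀ q j s,
    rightAct stateOp (toAlg K V u) q j s = ⁅q j s, u⁆ + q (j + 1) (insertAfter v s) := by
  induction u using FreeLie.induction with
  | hι v => exact ⟨v, fun q j s => by rw [toAlg_ι, rightAct_ι, stateOp_apply]⟩
  | h0 => exact ⟨0, by simp⟩
  | hadd x y hx hy =>
    obtain ⟨a, ha⟩ := hx
    obtain ⟨b, hb⟩ := hy
    refine ⟨a + b, fun q j s => ?_⟩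
    simp only [map_add, LinearMap.add_apply, Pi.add_apply, ha, hb, lie_add]
    abel
  | hsmul c x hx =>
    obtain ⟨a, ha⟩ := hx
    refine ⟨c • a, fun q j s => ?_⟩
    simp only [map_smul, LinearMap.smul_apply, Pi.smul_apply, ha, lie_smul, smul_add]
  | hlie x y hx hy =>
    obtain ⟨a, ha⟩ := hx
    obtain ⟨b, hb⟩ := hy
    refine ⟨0, fun q j s => ?_⟩
    simp only [toAlg_lie, map_sub, LinearMap.sub_apply, Pi.sub_apply, rightAct_mul, ha, hb,
      add_lie, map_zero, LinearMap.zero_apply, add_zero, insertAfter_comm a b]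
    rw [leibniz_lie (q j s) x y, ← lie_skew x ⁅q j s, y⁆]
    abel

theorem derivedSeries_one_induction {L : Type*} [LieRing L] [LieAlgebra K L] {P : L → Prop}
    (zero : P 0) (add : ∀ x y, P x → P y → P (x + y)) (smul : ∀ (c : K) x, P x → P (c • x))
    (lie : ∀ x y : L, P ⁅x, y⁆) (u : L) (hu : u ∈ LieAlgebra.derivedSeries K L 1) : P u := by
  rw [LieAlgebra.derivedSeries_def, LieAlgebra.derivedSeriesOfIdeal_succ,
    ← LieSubmodule.mem_toSubmodule, LieSubmodule.lieIdeal_oper_eq_linear_span'] at hu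
  induction hu using Submodule.span_induction with
  | mem u hu =>
    obtain ⟨x, -, y, -, rfl⟩ := hu
    exact lie x y
  | zero => exact zero
  | add x y _ _ hx hy => exact add x y hx hy
  | smul c x _ hx => exact smul c x hx

theorem stateOp_toAlg {w : FreeLie K V} (hw : w ∈ LieAlgebra.derivedSeries K (FreeLie K V) 1)
    (q : ℕ → TensorAlgebra K V →ₗ[K] FreeLie K V) (j : ℕ) (s : TensorAlgebra K V) :
    rightAct stateOp (toAlg K V w) q j s = ⁅q j s, w⁆ := by
  revert q j s
  refine derivedSeries_one_induction (K := K) (P := fun w => ∀ q j s,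
    rightAct stateOp (toAlg K V w) q j s = ⁅q j s, w⁆) ?_ ?_ ?_ ?_ w hw
  · simp
  · intro x y hx hy q j s
    simp [hx, hy]
  · intro c x hx q j s
    simp [hx]
  · intro x y q j s
    obtain ⟨a, ha⟩ := exists_stateOp_toAlg x
    obtain ⟨b, hb⟩ := exists_stateOp_toAlg y
    simp only [toAlg_lie, map_sub, LinearMap.sub_apply, Pi.sub_apply, rightAct_mul, ha, hb,
      add_lie, insertAfter_comm a b]
    rw [leibniz_lie (q j s) x y, ← lie_skew x ⁅q j s, y⁆]
    abel

/-- The linear map `T(V) → L(V)` with `a₁ ⊗ ⋯ ⊗ aₙ ↦ [a₁, a₂, …, aₙ]`. -/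
def leftBracketing (K V : Type*) [CommRing K] [AddCommGroup V] [Module K V] :
    TensorAlgebra K V →ₗ[K] FreeLie K V :=
  bracketing LinearMap.id

theorem leftBracketing_one : leftBracketing K V 1 = 0 := headMap_one _

theorem leftBracketing_ι_mul (v : V) (t : TensorAlgebra K V) :
    leftBracketing K V (TensorAlgebra.ι K v * t) = lieAct K V t (FreeLie.ι K v) :=
  headMap_ι_mul _ _ _

theorem lieDer_leftBracketing (f : Module.End K V) (t : TensorAlgebra K V) :
    lieDer f (leftBracketing K V t) =
      leftBracketing K V (algDer (TensorAlgebra.ι K ∘ₗ f) t) := by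
  induction t using tensorAlgebra_left_induction with
  | one => simp [leftBracketing_one]
  | add s t hs ht => simp [hs, ht]
  | smul c t ht => simp [ht]
  | ι_mul v t ht =>
    simp only [leftBracketing_ι_mul, lieDer_lieAct, algDer_mul, algDer_ι, map_add,
      LinearMap.comp_apply, lieDer_ι]
    rw [add_comm]

theorem leftBracketing_mem {n : ℕ} {t : TensorAlgebra K V} (ht : t ∈ words K V n) :
    leftBracketing K V t ∈ liePowerSpan K V n := by
  induction ht using Submodule.span_induction with
  | zero => simp
  | add x y _ _ hx hy => rw [map_add]; exact add_mem hx hy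
  | smul c x _ hx => rw [map_smul]; exact Submodule.smul_mem _ c hx
  | mem t ht =>
    obtain ⟨l, rfl, rfl⟩ := ht
    cases l with
    | nil => simp [leftBracketing_one]
    | cons a l =>
      rw [word_cons, leftBracketing_ι_mul, ← leftNormed_eq_lieAct]
      exact leftNormed_mem a l

variable (κ : ℕ → K)

/-- The sequence of multiples of the left-normed bracketing with coefficients `κ`. -/
def startState : ℕ → TensorAlgebra K V →ₗ[K] FreeLie K V := fun j => κ j • leftBracketing K V

/-- `symBracket κ` sends `x ⊗ y₁ ⊗ ⋯ ⊗ yₘ` to the sum over the subsets `I` of `{1, …, m}` and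
the permutations `s` of `I` of the products `κ |I| • [x, y_{s(I)}, y_{Iᶜ}]`. -/
def symBracket : TensorAlgebra K V →ₗ[K] FreeLie K V :=
  headMap (LinearMap.mk₂ K
    (fun v t => rightAct stateOp t (startState κ) 0 (TensorAlgebra.ι K v))
    (fun _ _ _ => by simp) (fun _ _ _ => by simp) (fun _ _ _ => by simp) (fun _ _ _ => by simp))

theorem symBracket_ι_mul (v : V) (t : TensorAlgebra K V) :
    symBracket κ (TensorAlgebra.ι K v * t) =
      rightAct stateOp t (startState κ) 0 (TensorAlgebra.ι K v) :=
  headMap_ι_mul _ _ _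

theorem symBracket_one : symBracket κ (1 : TensorAlgebra K V) = 0 := headMap_one _

theorem symBracket_ι (v : V) : symBracket κ (TensorAlgebra.ι K v) = κ 0 • FreeLie.ι K v := by
  rw [← mul_one (TensorAlgebra.ι K v), symBracket_ι_mul, rightAct_one, startState,
    LinearMap.smul_apply, ← mul_one (TensorAlgebra.ι K v), leftBracketing_ι_mul, lieAct_one]

theorem symBracket_ι_mul_toAlg {w : FreeLie K V}
    (hw : w ∈ LieAlgebra.derivedSeries K (FreeLie K V) 1) (v : V) :
    symBracket κ (TensorAlgebra.ι K v * toAlg K V w) = κ 0 • ⁅FreeLie.ι K v, w⁆ := by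
  rw [symBracket_ι_mul, stateOp_toAlg hw, ← smul_lie, ← symBracket_ι κ v,
    ← mul_one (TensorAlgebra.ι K v), symBracket_ι_mul, rightAct_one, mul_one]

/-- Elements of L' act on states by brackets alone, so `headMap_toAlg_lie` applies. This rule
produces the eigenvalue k on products of k elements of L'. -/
theorem symBracket_toAlg_lie {u w : FreeLie K V}
    (hu : u ∈ LieAlgebra.derivedSeries K (FreeLie K V) 1)
    (hw : w ∈ LieAlgebra.derivedSeries K (FreeLie K V) 1) :
    symBracket κ (toAlg K V ⁅u, w⁆) =
      ⁅symBracket κ (toAlg K V u), w⁆ + ⁅u, symBracket κ (toAlg K V w)⁆ := by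
  refine headMap_toAlg_lie _ u w (fun v t => ?_) (fun v t => ?_) <;>
    simp only [LinearMap.mk₂_apply, rightAct_mul]
  · exact stateOp_toAlg hu _ _ _
  · exact stateOp_toAlg hw _ _ _

/-- The construction of the states is natural in V, hence compatible with derivations. This is the
source of the K[σ]-linearity of φ. -/
theorem lieDer_state (f : Module.End K V) (t : TensorAlgebra K V) (j : ℕ)
    (s : TensorAlgebra K V) :
    lieDer f (rightAct stateOp t (startState κ) j s) =
      rightAct stateOp (algDer (TensorAlgebra.ι K ∘ₗ f) t) (startState κ) j s +
        rightAct stateOp t (startState κ) j (algDer (TensorAlgebra.ι K ∘ₗ f) s) := by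
  induction t using tensorAlgebra_right_induction generalizing j s with
  | one => simp [startState, lieDer_leftBracketing]
  | add t t' ht ht' =>
    simp only [map_add, LinearMap.add_apply, Pi.add_apply, ht, ht']
    abel
  | smul c t ht => simp [ht]
  | mul_ι t b ht =>
    simp only [rightAct_mul, rightAct_ι, stateOp_apply, map_add, LieDerivation.apply_lie_eq_add,
      ht, lieDer_ι, algDer_mul, algDer_ι, LinearMap.comp_apply, LinearMap.add_apply, Pi.add_apply,
      add_lie, algDer_insertAfter]
    abel

theorem lieDer_symBracket (f : Module.End K V) (t : TensorAlgebra K V) :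
    lieDer f (symBracket κ t) = symBracket κ (algDer (TensorAlgebra.ι K ∘ₗ f) t) := by
  induction t using tensorAlgebra_left_induction with
  | one => simp [symBracket_one]
  | add s t hs ht => simp [hs, ht]
  | smul c t ht => simp [ht]
  | ι_mul v t ht =>
    simp only [symBracket_ι_mul, lieDer_state, algDer_mul, algDer_ι, map_add,
      LinearMap.comp_apply]
    rw [add_comm]

theorem state_mem (l : List V) (j : ℕ) {n : ℕ} {s : TensorAlgebra K V} (hs : s ∈ words K V n) :
    rightAct stateOp (word K l) (startState κ) j s ∈ liePowerSpan K V (n + l.length) := by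
  induction l using List.reverseRecOn generalizing j n s with
  | nil =>
    simp only [word_nil, rightAct_one, startState, LinearMap.smul_apply, List.length_nil, add_zero]
    exact Submodule.smul_mem _ _ (leftBracketing_mem hs)
  | append_singleton l b ih =>
    rw [word_append, word_cons, word_nil, mul_one, rightAct_mul, rightAct_ι, stateOp_apply,
      List.length_append, List.length_singleton]
    refine add_mem (lie_ι_mem (ih j hs) b) ?_
    have := ih (j + 1) (insertAfter_mem_words hs b)
    rwa [add_right_comm, add_assoc] at this

theorem symBracket_mem {n : ℕ} {t : TensorAlgebra K V} (ht : t ∈ words K V n) :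
    symBracket κ t ∈ liePowerSpan K V n := by
  induction ht using Submodule.span_induction with
  | zero => simp
  | add x y _ _ hx hy => rw [map_add]; exact add_mem hx hy
  | smul c x _ hx => rw [map_smul]; exact Submodule.smul_mem _ c hx
  | mem t ht =>
    obtain ⟨l, rfl, rfl⟩ := ht
    cases l with
    | nil => simp [symBracket_one]
    | cons a l =>
      rw [word_cons, symBracket_ι_mul, List.length_cons, add_comm]
      exact state_mem κ l 0 (ι_mem_words a)

end SymBracket

/-! ### Symmetrized brackets modulo the second derived algebra -/

section Coefficients

variable (K : Type*) [Field K]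

/-- The iterated differences of the function `m ↦ ∑ i < m, 1 / (i + 2)`. -/
def diffCoeff : ℕ → ℕ → K
  | 0, m => ∑ i ∈ Finset.range m, ((i + 2 : ℕ) : K)⁻¹
  | j + 1, m => diffCoeff j (m + 1) - diffCoeff j m

theorem diffCoeff_succ (j m : ℕ) :
    diffCoeff K (j + 1) m = diffCoeff K j (m + 1) - diffCoeff K j m := by
  rw [diffCoeff]

theorem diffCoeff_add (j m : ℕ) :
    diffCoeff K j m + diffCoeff K (j + 1) m = diffCoeff K j (m + 1) := by
  rw [diffCoeff_succ, add_sub_cancel]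

theorem diffCoeff_zero_zero : diffCoeff K 0 0 = 0 := by simp [diffCoeff]

/-- In characteristic p the value at m = p - 2 is 0, by the convention for the inverse of zero. This
is the value wanted: it makes φ vanish modulo L'' in degree p. -/
theorem diffCoeff_one (m : ℕ) : diffCoeff K 1 m = ((m + 2 : ℕ) : K)⁻¹ := by
  rw [diffCoeff_succ, diffCoeff, diffCoeff, Finset.sum_range_succ, add_sub_cancel_left]

/-- The coefficients for which the symmetrized bracketing acts as the identity modulo the second
derived algebra in degrees less than the characteristic. -/
def symCoeff (j : ℕ) : K := diffCoeff K j 0 / ((j - 1).factorial : K)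

theorem symCoeff_zero : symCoeff K 0 = 0 := by simp [symCoeff, diffCoeff_zero_zero]

end Coefficients

section Quotient

variable {K V M : Type*} [Field K] [AddCommGroup V] [Module K V] [LieRing M] [LieAlgebra K M]
  (π : FreeLie K V →ₗ⁅K⁆ M)

theorem insertAfter_ι_mul_shuffles (b x : V) (J : List V) :
    insertAfter b (TensorAlgebra.ι K x * shuffles K J) =
      TensorAlgebra.ι K x * shuffles K (b :: J) := by
  rw [insertAfter_mul, insertAfter_ι, shuffles, mul_add, mul_assoc]

theorem map_lieAct (t : TensorAlgebra K V) (u : FreeLie K V) :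
    π (lieAct K V t u) =
      rightAct (adR ((π : FreeLie K V →ₗ[K] M) ∘ₗ FreeLie.ι K)) t (π u) :=
  map_rightAct_adR π _ t u

/-- The last letter `b` of the word is either bracketed or joins `J`, and `diffCoeff_add` is the
Pascal rule that matches the coefficients of the two options. The length bound makes the factorial
in `symCoeff` invertible. For empty `l` the truncated `l.length - 1` is harmless, since then the
second `pairSum` is zero. -/
theorem map_state {p : ℕ} (hp : p.Prime) [CharP K p]
    (hM : ∀ a b c d : M, ⁅⁅a, b⁆, ⁅c, d⁆⁆ = 0) (x : V) (l J : List V)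
    (h : l.length + J.length < p) :
    π (rightAct stateOp (word K l) (startState (symCoeff K)) J.length
        (TensorAlgebra.ι K x * shuffles K J)) =
      diffCoeff K J.length l.length • listAct ((π : FreeLie K V →ₗ[K] M) ∘ₗ FreeLie.ι K)
        (pairSum ((π : FreeLie K V →ₗ[K] M) ∘ₗ FreeLie.ι K) (π (FreeLie.ι K x)) J) l +
      diffCoeff K (J.length + 1) (l.length - 1) •
        listAct ((π : FreeLie K V →ₗ[K] M) ∘ₗ FreeLie.ι K)
        (pairSum ((π : FreeLie K V →ₗ[K] M) ∘ₗ FreeLie.ι K) (π (FreeLie.ι K x)) l) J := by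
  set j := (π : FreeLie K V →ₗ[K] M) ∘ₗ FreeLie.ι K with hj
  induction l using List.reverseRecOn generalizing J with
  | nil =>
    simp only [word_nil, rightAct_one, startState, LinearMap.smul_apply, leftBracketing_ι_mul,
      map_smul, map_lieAct, ← hj, pairSum_nil, listAct_nil, listAct_zero, smul_zero, add_zero,
      List.length_nil]
    cases J with
    | nil => simp [symCoeff_zero]
    | cons c J =>
      have hf : (J.length.factorial : K) ≠ 0 := by
        rw [Ne, CharP.cast_eq_zero_iff K p, hp.dvd_factorial, not_le]
        simp only [List.length_nil, List.length_cons] at h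
        omega
      rw [rightAct_shuffles_cons j hM, smul_smul, symCoeff, List.length_cons,
        Nat.add_sub_cancel, div_mul_cancel₀ _ hf]
  | append_singleton l b ih =>
    rw [List.length_append, List.length_singleton] at h
    have hb : π (FreeLie.ι K b) = j b := rfl
    have h1 := ih J (by omega)
    have h2 := ih (b :: J) (by rw [List.length_cons]; omega)
    rw [List.length_cons] at h2
    rw [word_append, word_cons, word_nil, mul_one, rightAct_mul, rightAct_ι, stateOp_apply,
      insertAfter_ι_mul_shuffles, map_add, LieHom.map_lie, h1, h2, List.length_append,
      List.length_singleton, Nat.add_sub_cancel, listAct_append_singleton, hb,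
      pairSum_append_singleton j hM, pairSum_cons, ← diffCoeff_add K J.length l.length]
    simp only [add_lie, smul_lie, listAct_add, listAct_cons, listAct_pairSum_lie j hM]
    rw [listAct_listAct_comm j hM _ _ J l]
    cases l with
    | nil =>
      simp only [pairSum_nil, zero_lie, listAct_zero, smul_zero]
      module
    | cons c l =>
      rw [List.length_cons, Nat.add_sub_cancel, ← diffCoeff_add K (J.length + 1) l.length]
      module

theorem map_symBracket_word {p : ℕ} (hp : p.Prime) [CharP K p]
    (hM : ∀ a b c d : M, ⁅⁅a, b⁆, ⁅c, d⁆⁆ = 0) (x : V) (l : List V) (h : l.length < p) :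
    π (symBracket (symCoeff K) (word K (x :: l))) = ((l.length + 1 : ℕ) : K)⁻¹ •
        pairSum ((π : FreeLie K V →ₗ[K] M) ∘ₗ FreeLie.ι K) (π (FreeLie.ι K x)) l := by
  have := map_state π hp hM x l [] (by simpa using h)
  simp only [shuffles, mul_one, List.length_nil, pairSum_nil, listAct_zero, smul_zero, zero_add,
    listAct_nil, diffCoeff_one] at this
  rw [word_cons, symBracket_ι_mul, this]
  cases l with
  | nil => simp
  | cons c l => rw [List.length_cons, Nat.add_sub_cancel, add_assoc]

theorem map_symBracket_eq_zero {p : ℕ} (hp : p.Prime) [CharP K p]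
    (hM : ∀ a b c d : M, ⁅⁅a, b⁆, ⁅c, d⁆⁆ = 0) {t : TensorAlgebra K V} (ht : t ∈ words K V p) :
    π (symBracket (symCoeff K) t) = 0 := by
  induction ht using Submodule.span_induction with
  | zero => simp
  | add x y _ _ hx hy => simp [hx, hy]
  | smul c x _ hx => simp [hx]
  | mem t ht =>
    obtain ⟨l, hl, rfl⟩ := ht
    cases l with
    | nil => simp [symBracket_one]
    | cons x l =>
      rw [List.length_cons] at hl
      -- The coefficient is the inverse of p, that is, of zero in K, and so equals 0 by convention.
      rw [map_symBracket_word π hp hM x l (by omega), hl, CharP.cast_eq_zero, inv_zero, zero_smul]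

/-- The new term of `pairSum` is [x, b, …] = -[b, x, …], that is, minus the action of `t` on `b`. In
this form the formula is linear in `t` and applies to Lie elements. -/
theorem map_symBracket_mul_ι {p : ℕ} (hp : p.Prime) [CharP K p]
    (hM : ∀ a b c d : M, ⁅⁅a, b⁆, ⁅c, d⁆⁆ = 0) {n : ℕ} (hn : n + 1 < p) {t : TensorAlgebra K V}
    (ht : t ∈ words K V (n + 1)) (b : V) :
    π (symBracket (symCoeff K) (t * TensorAlgebra.ι K b)) = ((n + 2 : ℕ) : K)⁻¹ •
      (((n + 1 : ℕ) : K) • ⁅π (symBracket (symCoeff K) t), π (FreeLie.ι K b)⁆ -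
        π (lieAct K V t (FreeLie.ι K b))) := by
  set j := (π : FreeLie K V →ₗ[K] M) ∘ₗ FreeLie.ι K with hj
  have hb : ∀ b, π (FreeLie.ι K b) = j b := fun _ => rfl
  induction ht using Submodule.span_induction with
  | zero => simp
  | add x y _ _ hx hy =>
    simp only [add_mul, map_add, hx, hy, add_lie, LinearMap.add_apply]
    module
  | smul c x _ hx =>
    simp only [smul_mul_assoc, map_smul, hx, smul_lie, LinearMap.smul_apply]
    module
  | mem t ht =>
    obtain ⟨l, hl, rfl⟩ := ht
    cases l with
    | nil => simp at hl
    | cons x l =>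
      rw [List.length_cons, Nat.add_right_cancel_iff] at hl
      have hne : ((n + 1 : ℕ) : K) ≠ 0 := by
        rw [Ne, CharP.cast_eq_zero_iff K p]
        exact Nat.not_dvd_of_pos_of_lt (Nat.succ_pos _) hn
      have h1 : word K (x :: l) * TensorAlgebra.ι K b = word K (x :: (l ++ [b])) := by
        simp [mul_assoc]
      rw [h1, map_symBracket_word π hp hM x (l ++ [b]) (by simp [hl, hn]),
        map_symBracket_word π hp hM x l (by omega), map_lieAct, ← hj, rightAct_word, hl,
        pairSum_append_singleton j hM, List.length_append, List.length_singleton, hl,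
        smul_lie, smul_smul, mul_inv_cancel₀ hne, one_smul, listAct_cons, hb, hb,
        ← lie_skew (j x) (j b), ← neg_one_smul K ⁅j b, j x⁆, listAct_smul, neg_one_smul,
        ← sub_eq_add_neg]

theorem mem_derivedSeries_one_of_mem_liePowerSpan {n : ℕ} {u : FreeLie K V}
    (hu : u ∈ liePowerSpan K V (n + 2)) : u ∈ LieAlgebra.derivedSeries K (FreeLie K V) 1 := by
  induction hu using Submodule.span_induction with
  | zero => exact zero_mem _
  | add x y _ _ hx hy => exact add_mem hx hy
  | smul c x _ hx => exact (LieSubmodule.toSubmodule _).smul_mem c hx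
  | mem u hu =>
    obtain ⟨a, l, hl, rfl⟩ := hu
    induction l using List.reverseRecOn with
    | nil => simp at hl
    | append_singleton l b _ =>
      rw [leftNormed_append_singleton, LieAlgebra.derivedSeries_def,
        LieAlgebra.derivedSeriesOfIdeal_succ]
      exact LieSubmodule.lie_mem_lie (LieSubmodule.mem_top _) (LieSubmodule.mem_top _)

theorem map_symBracket_toAlg {p : ℕ} (hp : p.Prime) [CharP K p]
    (hM : ∀ a b c d : M, ⁅⁅a, b⁆, ⁅c, d⁆⁆ = 0) {n : ℕ} (hn : n + 2 < p) {u : FreeLie K V}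
    (hu : u ∈ liePowerSpan K V (n + 2)) : π (symBracket (symCoeff K) (toAlg K V u)) = π u := by
  induction n generalizing u with
  | zero =>
    induction hu using Submodule.span_induction with
    | zero => simp
    | add x y _ _ hx hy => simp [hx, hy]
    | smul c x _ hx => simp [hx]
    | mem u hu =>
      obtain ⟨a, l, hl, rfl⟩ := hu
      obtain ⟨b, rfl⟩ := List.length_eq_one_iff.1 (show l.length = 1 by omega)
      have h2 : ((2 : ℕ) : K) ≠ 0 := by
        rw [Ne, CharP.cast_eq_zero_iff K p]
        exact Nat.not_dvd_of_pos_of_lt two_pos hn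
      have h : ∀ a b : V, π (symBracket (symCoeff K)
          (TensorAlgebra.ι K a * TensorAlgebra.ι K b)) =
          ((2 : ℕ) : K)⁻¹ • ⁅π (FreeLie.ι K a), π (FreeLie.ι K b)⁆ := by
        intro a b
        have := map_symBracket_word π hp hM a [b] (by simpa using hp.one_lt)
        simpa [pairSum_cons] using this
      have h3 : leftNormed K a [b] = ⁅FreeLie.ι K a, FreeLie.ι K b⁆ := rfl
      rw [h3, toAlg_lie, toAlg_ι, toAlg_ι, map_sub, map_sub, h, h, LieHom.map_lie,
        ← lie_skew (π (FreeLie.ι K b)), smul_neg, sub_neg_eq_add, ← two_smul K, smul_smul]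
      rw [show (2 : K) = ((2 : ℕ) : K) by norm_num, mul_inv_cancel₀ h2, one_smul]
  | succ n ih =>
    induction hu using Submodule.span_induction with
    | zero => simp
    | add x y _ _ hx hy => simp [hx, hy]
    | smul c x _ hx => simp [hx]
    | mem u hu =>
      obtain ⟨a, l, hl, rfl⟩ := hu
      induction l using List.reverseRecOn with
      | nil => simp at hl
      | append_singleton l b _ =>
        have hl' : l.length + 1 = n + 2 := by simp at hl; omega
        have hu' : leftNormed K a l ∈ liePowerSpan K V (n + 2) := hl' ▸ leftNormed_mem a l
        have hne : ((n + 3 : ℕ) : K) ≠ 0 := by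
          rw [Ne, CharP.cast_eq_zero_iff K p]
          exact Nat.not_dvd_of_pos_of_lt (Nat.succ_pos _) hn
        -- Write u for the shorter product, so that the commutator is ub - bu. The term bu
        -- contributes κ 0 = 0. The term ub contributes (n+3)⁻¹((n+2)[u, b] - [b, u]), which is [u,
        -- b] modulo L''.
        rw [leftNormed_append_singleton, toAlg_lie, toAlg_ι, map_sub, map_sub,
          symBracket_ι_mul_toAlg _ (mem_derivedSeries_one_of_mem_liePowerSpan hu'), symCoeff_zero,
          zero_smul, map_zero, sub_zero,
          map_symBracket_mul_ι π hp hM (by omega) (toAlg_mem_words hu') b, ih (by omega) hu',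
          lieAct_toAlg,
          ← lie_skew (FreeLie.ι K b) (leftNormed K a l), map_neg, sub_neg_eq_add, LieHom.map_lie,
          ← one_smul K (⁅π (leftNormed K a l), π (FreeLie.ι K b)⁆), smul_smul, ← add_smul,
          smul_smul, mul_one, ← Nat.cast_succ, inv_mul_cancel₀ hne]

end Quotient

/-! ### The lower central series of the derived algebra, by degree -/

section WeightSpan

variable {K V : Type*} [Field K] [AddCommGroup V] [Module K V]

theorem liePowerSpan_zero : liePowerSpan K V 0 = ⊥ := by
  rw [liePowerSpan, Submodule.span_eq_bot]
  rintro _ ⟨a, l, hl, rfl⟩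
  omega

theorem lie_mem_liePowerSpan {i j : ℕ} {u w : FreeLie K V} (hu : u ∈ liePowerSpan K V i)
    (hw : w ∈ liePowerSpan K V j) : ⁅u, w⁆ ∈ liePowerSpan K V (i + j) := by
  induction hw using Submodule.span_induction with
  | zero => simp
  | add x y _ _ hx hy => rw [lie_add]; exact add_mem hx hy
  | smul c x _ hx => rw [lie_smul]; exact Submodule.smul_mem _ c hx
  | mem w hw =>
    obtain ⟨a, l, rfl, rfl⟩ := hw
    induction l using List.reverseRecOn generalizing i u with
    | nil => exact lie_ι_mem hu a
    | append_singleton l b ih =>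
      rw [leftNormed_append_singleton, leibniz_lie,
        ← lie_skew (leftNormed K a l) ⁅u, FreeLie.ι K b⁆, ← sub_eq_add_neg, List.length_append,
        List.length_singleton]
      refine sub_mem (lie_ι_mem (ih hu) b) ?_
      convert ih (lie_ι_mem hu b) using 2
      ring

variable (K V) in
/-- The degree `n` part of the `(k + 1)`-th term of the lower central series of the derived
algebra of the free Lie algebra. -/
def weightSpan : ℕ → ℕ → Submodule K (FreeLie K V)
  | 0, n => if 2 ≤ n then liePowerSpan K V n else ⊥
  | k + 1, n => Submodule.span K {z | ∃ i j u w, i + j = n ∧ u ∈ weightSpan k i ∧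
      w ∈ (if 2 ≤ j then liePowerSpan K V j else ⊥) ∧ z = ⁅u, w⁆}

theorem weightSpan_zero {n : ℕ} (hn : 2 ≤ n) : weightSpan K V 0 n = liePowerSpan K V n := by
  rw [weightSpan, if_pos hn]

theorem weightSpan_zero_of_lt {n : ℕ} (hn : n < 2) : weightSpan K V 0 n = ⊥ := by
  rw [weightSpan, if_neg (not_le.2 hn)]

theorem weightSpan_succ (k n : ℕ) : weightSpan K V (k + 1) n =
    Submodule.span K {z | ∃ i j u w, i + j = n ∧ u ∈ weightSpan K V k i ∧
      w ∈ weightSpan K V 0 j ∧ z = ⁅u, w⁆} := rfl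

/-- Each of the k + 1 factors from L' has degree at least 2. -/
theorem weightSpan_eq_bot {k n : ℕ} (h : n < 2 * (k + 1)) : weightSpan K V k n = ⊥ := by
  induction k generalizing n with
  | zero => exact weightSpan_zero_of_lt h
  | succ k ih =>
    rw [weightSpan_succ, Submodule.span_eq_bot]
    rintro _ ⟨i, j, u, w, hij, hu, hw, rfl⟩
    rcases lt_or_ge j 2 with hj | hj
    · rw [weightSpan_zero_of_lt hj, Submodule.mem_bot] at hw
      rw [hw, lie_zero]
    · rw [ih (by omega), Submodule.mem_bot] at hu
      rw [hu, zero_lie]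

theorem weightSpan_le (k n : ℕ) : weightSpan K V k n ≤ liePowerSpan K V n := by
  have h0 : ∀ n, weightSpan K V 0 n ≤ liePowerSpan K V n := by
    intro n
    rcases lt_or_ge n 2 with hn | hn
    · rw [weightSpan_zero_of_lt hn]; exact bot_le
    · rw [weightSpan_zero hn]
  induction k generalizing n with
  | zero => exact h0 n
  | succ k ih =>
    rw [weightSpan_succ, Submodule.span_le]
    rintro _ ⟨i, j, u, w, rfl, hu, hw, rfl⟩
    exact lie_mem_liePowerSpan (ih i hu) (h0 j hw)

theorem lie_mem_weightSpan {k i j : ℕ} {u w : FreeLie K V} (hu : u ∈ weightSpan K V k i)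
    (hw : w ∈ weightSpan K V 0 j) : ⁅u, w⁆ ∈ weightSpan K V (k + 1) (i + j) :=
  Submodule.subset_span ⟨i, j, u, w, rfl, hu, hw, rfl⟩

theorem lie_mem_weightSpan_one {k i j : ℕ} {u w : FreeLie K V} (hu : u ∈ weightSpan K V k i)
    (hw : w ∈ weightSpan K V 1 j) : ⁅u, w⁆ ∈ weightSpan K V (k + 2) (i + j) := by
  rw [weightSpan_succ] at hw
  induction hw using Submodule.span_induction with
  | zero => simp
  | add x y _ _ hx hy => rw [lie_add]; exact add_mem hx hy
  | smul c x _ hx => rw [lie_smul]; exact Submodule.smul_mem _ c hx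
  | mem w hw =>
    obtain ⟨a, b, y, z, rfl, hy, hz, rfl⟩ := hw
    rw [leibniz_lie, ← lie_skew y, ← sub_eq_add_neg]
    refine sub_mem ?_ ?_
    · rw [← add_assoc]
      exact lie_mem_weightSpan (lie_mem_weightSpan hu hy) hz
    · rw [add_comm a b, ← add_assoc]
      exact lie_mem_weightSpan (lie_mem_weightSpan hu hz) hy

theorem weightSpan_succ_le (k n : ℕ) : weightSpan K V (k + 1) n ≤ weightSpan K V k n := by
  induction k generalizing n with
  | zero =>
    rcases lt_or_ge n 2 with hn | hn
    · rw [weightSpan_eq_bot (by omega)]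
      exact bot_le
    · rw [weightSpan_zero hn]
      exact weightSpan_le 1 n
  | succ k ih =>
    rw [weightSpan_succ, weightSpan_succ]
    refine Submodule.span_mono ?_
    rintro _ ⟨i, j, u, w, hij, hu, hw, rfl⟩
    exact ⟨i, j, u, w, hij, ih i hu, hw, rfl⟩

theorem weightSpan_le_one {k : ℕ} (hk : 1 ≤ k) (n : ℕ) :
    weightSpan K V k n ≤ weightSpan K V 1 n :=
  antitone_nat_of_succ_le (f := fun k => weightSpan K V k n) (fun k => weightSpan_succ_le k n) hk

theorem mem_derivedSeries_one_of_mem_weightSpan {k n : ℕ} {u : FreeLie K V}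
    (hu : u ∈ weightSpan K V k n) : u ∈ LieAlgebra.derivedSeries K (FreeLie K V) 1 := by
  rcases lt_or_ge n 2 with hn | hn
  · rw [weightSpan_eq_bot (by omega), Submodule.mem_bot] at hu
    rw [hu]
    exact zero_mem _
  · obtain ⟨n, rfl⟩ := Nat.exists_eq_add_of_le' hn
    exact mem_derivedSeries_one_of_mem_liePowerSpan (weightSpan_le k _ hu)

theorem mem_derivedSeries_two_of_mem_weightSpan {n : ℕ} {u : FreeLie K V}
    (hu : u ∈ weightSpan K V 1 n) : u ∈ LieAlgebra.derivedSeries K (FreeLie K V) 2 := by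
  rw [weightSpan_succ] at hu
  induction hu using Submodule.span_induction with
  | zero => exact zero_mem _
  | add x y _ _ hx hy => exact add_mem hx hy
  | smul c x _ hx => exact (LieSubmodule.toSubmodule _).smul_mem c hx
  | mem u hu =>
    obtain ⟨i, j, u, w, -, hu, hw, rfl⟩ := hu
    rw [LieAlgebra.derivedSeries_def, LieAlgebra.derivedSeriesOfIdeal_succ]
    exact LieSubmodule.lie_mem_lie (mem_derivedSeries_one_of_mem_weightSpan hu)
      (mem_derivedSeries_one_of_mem_weightSpan hw)

theorem lie_mem_iSup {P Q R : ℕ → Submodule K (FreeLie K V)}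
    (h : ∀ i j, ∀ u ∈ P i, ∀ w ∈ Q j, ⁅u, w⁆ ∈ R (i + j)) {u w : FreeLie K V}
    (hu : u ∈ ⨆ i, P i) (hw : w ∈ ⨆ i, Q i) : ⁅u, w⁆ ∈ ⨆ i, R i := by
  refine Submodule.iSup_induction P (motive := fun u => ⁅u, w⁆ ∈ ⨆ i, R i) hu ?_ (by simp)
    (fun x y hx hy => by rw [add_lie]; exact add_mem hx hy)
  intro i u hu
  refine Submodule.iSup_induction Q (motive := fun w => ⁅u, w⁆ ∈ ⨆ i, R i) hw ?_ (by simp)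
    (fun x y hx hy => by rw [lie_add]; exact add_mem hx hy)
  exact fun j w hw => Submodule.mem_iSup_of_mem _ (h i j u hu w hw)

theorem mem_iSup_liePowerSpan (u : FreeLie K V) : u ∈ ⨆ n, liePowerSpan K V n := by
  induction u using FreeLie.induction with
  | hι v => exact Submodule.mem_iSup_of_mem 1 (leftNormed_mem v [])
  | h0 => exact zero_mem _
  | hadd x y hx hy => exact add_mem hx hy
  | hsmul c x hx => exact Submodule.smul_mem _ c hx
  | hlie x y hx hy =>
    exact lie_mem_iSup (fun i j u hu w hw => lie_mem_liePowerSpan hu hw) hx hy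

theorem mem_iSup_weightSpan_zero {u : FreeLie K V}
    (hu : u ∈ LieAlgebra.derivedSeries K (FreeLie K V) 1) : u ∈ ⨆ n, weightSpan K V 0 n := by
  refine derivedSeries_one_induction (K := K) (P := fun u => u ∈ ⨆ n, weightSpan K V 0 n)
    (zero_mem _) (fun x y hx hy => add_mem hx hy) (fun c x hx => Submodule.smul_mem _ c hx)
    (fun x y => ?_) u hu
  refine lie_mem_iSup (fun i j u hu w hw => ?_) (mem_iSup_liePowerSpan x) (mem_iSup_liePowerSpan y)
  rcases Nat.eq_zero_or_pos i with rfl | hi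
  · rw [liePowerSpan_zero, Submodule.mem_bot] at hu
    simp [hu]
  rcases Nat.eq_zero_or_pos j with rfl | hj
  · rw [liePowerSpan_zero, Submodule.mem_bot] at hw
    simp [hw]
  rw [weightSpan_zero (by omega)]
  exact lie_mem_liePowerSpan hu hw

theorem mem_iSup_weightSpan_one {u : FreeLie K V}
    (hu : u ∈ LieAlgebra.derivedSeries K (FreeLie K V) 2) : u ∈ ⨆ n, weightSpan K V 1 n := by
  rw [LieAlgebra.derivedSeries_def, LieAlgebra.derivedSeriesOfIdeal_succ,
    ← LieSubmodule.mem_toSubmodule, LieSubmodule.lieIdeal_oper_eq_linear_span'] at hu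
  induction hu using Submodule.span_induction with
  | zero => exact zero_mem _
  | add x y _ _ hx hy => exact add_mem hx hy
  | smul c x _ hx => exact Submodule.smul_mem _ c hx
  | mem u hu =>
    obtain ⟨x, hx, y, hy, rfl⟩ := hu
    exact lie_mem_iSup (fun i j u hu w hw => lie_mem_weightSpan hu hw)
      (mem_iSup_weightSpan_zero hx) (mem_iSup_weightSpan_zero hy)

/-- A decomposition of `u` in L'' into homogeneous pieces may involve other degrees; the degree `n`
part in the tensor algebra discards them, and injectivity for `n ≤ p` brings the equality back to
L(V). -/
theorem mem_weightSpan_one {p : ℕ} (hp : p.Prime) [CharP K p] {n : ℕ} (hn : n ≤ p)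
    {u : FreeLie K V} (hu : u ∈ liePowerSpan K V n)
    (hu' : u ∈ LieAlgebra.derivedSeries K (FreeLie K V) 2) : u ∈ weightSpan K V 1 n := by
  have key : ∃ w ∈ weightSpan K V 1 n, tensorPart K V n u = tensorPart K V n w := by
    refine Submodule.iSup_induction (weightSpan K V 1) (motive := fun u =>
      ∃ w ∈ weightSpan K V 1 n, tensorPart K V n u = tensorPart K V n w)
      (mem_iSup_weightSpan_one hu') ?_ ⟨0, zero_mem _, rfl⟩ ?_
    · intro m u hu
      by_cases h : m = n
      · exact ⟨u, h ▸ hu, rfl⟩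
      · exact ⟨0, zero_mem _, by rw [map_zero, tensorPart_of_ne (weightSpan_le 1 m hu) h]⟩
    · rintro x y ⟨x', hx', hx⟩ ⟨y', hy', hy⟩
      exact ⟨x' + y', add_mem hx' hy', by rw [map_add, map_add, hx, hy]⟩
  obtain ⟨w, hw, h⟩ := key
  have : u - w = 0 := eq_zero_of_tensorPart_eq_zero hp hn
    ((liePowerSpan K V n).sub_mem hu (weightSpan_le 1 n hw)) (by rw [map_sub, h, sub_self])
  rwa [sub_eq_zero.1 this]

end WeightSpan

/-! ### The symmetrized bracketing on the second derived algebra -/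

section Bijective

variable {K V : Type*} [Field K] [AddCommGroup V] [Module K V]

variable (K V) in
/-- The projection of the free Lie algebra to the free metabelian Lie algebra. -/
def toMetabelian : FreeLie K V →ₗ⁅K⁆ FreeLie K V ⧸ LieAlgebra.derivedSeries K (FreeLie K V) 2 where
  toFun := LieSubmodule.Quotient.mk
  map_add' _ _ := rfl
  map_smul' _ _ := rfl
  map_lie' := rfl

theorem toMetabelian_eq_zero {u : FreeLie K V} :
    toMetabelian K V u = 0 ↔ u ∈ LieAlgebra.derivedSeries K (FreeLie K V) 2 :=
  LieSubmodule.Quotient.mk_eq_zero _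

theorem metabelian_lie_lie_lie
    (a b c d : FreeLie K V ⧸ LieAlgebra.derivedSeries K (FreeLie K V) 2) :
    ⁅⁅a, b⁆, ⁅c, d⁆⁆ = 0 := by
  have hs : Function.Surjective (toMetabelian K V) := Submodule.Quotient.mk_surjective _
  obtain ⟨a, rfl⟩ := hs a
  obtain ⟨b, rfl⟩ := hs b
  obtain ⟨c, rfl⟩ := hs c
  obtain ⟨d, rfl⟩ := hs d
  rw [← LieHom.map_lie, ← LieHom.map_lie, ← LieHom.map_lie, toMetabelian_eq_zero]
  have h : ∀ x y : FreeLie K V, ⁅x, y⁆ ∈ LieAlgebra.derivedSeries K (FreeLie K V) 1 := by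
    intro x y
    rw [LieAlgebra.derivedSeries_def, LieAlgebra.derivedSeriesOfIdeal_succ]
    exact LieSubmodule.lie_mem_lie (LieSubmodule.mem_top _) (LieSubmodule.mem_top _)
  rw [LieAlgebra.derivedSeries_def, LieAlgebra.derivedSeriesOfIdeal_succ]
  exact LieSubmodule.lie_mem_lie (h _ _) (h _ _)

variable {p : ℕ} [CharP K p]

theorem symBracket_mem_weightSpan (hp : p.Prime) {t : TensorAlgebra K V}
    (ht : t ∈ words K V p) : symBracket (symCoeff K) t ∈ weightSpan K V 1 p :=
  mem_weightSpan_one hp le_rfl (symBracket_mem _ ht) (toMetabelian_eq_zero.1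
    (map_symBracket_eq_zero (toMetabelian K V) hp metabelian_lie_lie_lie ht))

theorem symBracket_sub_mem_of_zero (hp : p.Prime) {n : ℕ} (hn : n < p) {u : FreeLie K V}
    (hu : u ∈ weightSpan K V 0 n) :
    symBracket (symCoeff K) (toAlg K V u) - u ∈ weightSpan K V 1 n := by
  rcases lt_or_ge n 2 with h2 | h2
  · rw [weightSpan_zero_of_lt h2, Submodule.mem_bot] at hu
    simp [hu]
  · obtain ⟨n, rfl⟩ := Nat.exists_eq_add_of_le' h2
    rw [weightSpan_zero h2] at hu
    refine mem_weightSpan_one hp hn.le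
      (sub_mem (symBracket_mem _ (toAlg_mem_words hu)) hu) (toMetabelian_eq_zero.1 ?_)
    rw [map_sub, map_symBracket_toAlg _ hp metabelian_lie_lie_lie hn hu, sub_self]

/-- Each factor of a product adds 1 to the multiplier, by the derivation rule and the congruence φ ≡
1 modulo L'' in degrees less than p. The bound `n < p + k` keeps the factors in those degrees:
splitting off a factor lowers the degree by at least 2. -/
theorem symBracket_sub_mem (hp : p.Prime) {k n : ℕ} (hn : n < p + k) (hn' : n ≤ p)
    {u : FreeLie K V} (hu : u ∈ weightSpan K V k n) :
    symBracket (symCoeff K) (toAlg K V u) - ((k + 1 : ℕ) : K) • u ∈ weightSpan K V (k + 1) n := by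
  induction k generalizing n u with
  | zero => simpa using symBracket_sub_mem_of_zero hp hn hu
  | succ k ih =>
    rw [weightSpan_succ] at hu
    induction hu using Submodule.span_induction with
    | zero => simp
    | add x y _ _ hx hy =>
      rw [map_add, map_add, smul_add, add_sub_add_comm]
      exact add_mem hx hy
    | smul c x _ hx =>
      rw [map_smul, map_smul, smul_comm, ← smul_sub]
      exact Submodule.smul_mem _ c hx
    | mem u hu =>
      obtain ⟨i, j, u, w, rfl, hu, hw, rfl⟩ := hu
      rcases lt_or_ge i 2 with hi | hi
      · rw [weightSpan_eq_bot (by omega), Submodule.mem_bot] at hu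
        simp [hu]
      rcases lt_or_ge j 2 with hj | hj
      · rw [weightSpan_eq_bot (by omega), Submodule.mem_bot] at hw
        simp [hw]
      rw [symBracket_toAlg_lie _ (mem_derivedSeries_one_of_mem_weightSpan hu)
        (mem_derivedSeries_one_of_mem_weightSpan hw)]
      have h1 := lie_mem_weightSpan (ih (n := i) (by omega) (by omega) hu) hw
      have h2 := lie_mem_weightSpan_one hu
        (symBracket_sub_mem_of_zero hp (n := j) (by omega) hw)
      convert add_mem h1 h2 using 1
      simp only [sub_lie, lie_sub, smul_lie]
      push_cast
      module

/-- If φu = 0, then (k + 2)u moves from `weightSpan` level k + 1 to level k + 2. The multipliers 2,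
…, p - 1 are invertible, so `u` descends to a level that is zero. -/
theorem eq_zero_of_symBracket_eq_zero (hp : p.Prime) {u : FreeLie K V}
    (hu : u ∈ weightSpan K V 1 p) (h : symBracket (symCoeff K) (toAlg K V u) = 0) : u = 0 := by
  have key : ∀ k, k + 1 < p → u ∈ weightSpan K V (k + 1) p := by
    intro k hk
    induction k with
    | zero => exact hu
    | succ k ih =>
      have h1 := symBracket_sub_mem hp (by omega) le_rfl (ih (by omega))
      rw [h, zero_sub, ← smul_neg] at h1
      have hne : ((k + 1 + 1 : ℕ) : K) ≠ 0 := by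
        rw [Ne, CharP.cast_eq_zero_iff K p]
        exact Nat.not_dvd_of_pos_of_lt (Nat.succ_pos _) hk
      exact neg_mem_iff.1 ((Submodule.smul_mem_iff _ hne).1 h1)
  rcases Nat.lt_or_ge 2 p with h2 | h2
  · have h1 := key (p - 2) (by omega)
    rwa [weightSpan_eq_bot (by omega), Submodule.mem_bot] at h1
  · rwa [weightSpan_eq_bot (by omega), Submodule.mem_bot] at hu

theorem exists_symBracket_eq (hp : p.Prime) {u : FreeLie K V} (hu : u ∈ weightSpan K V 1 p) :
    ∃ w ∈ weightSpan K V 1 p, symBracket (symCoeff K) (toAlg K V w) = u := by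
  have key : ∀ m k, 1 ≤ k → k + m = p → ∀ u ∈ weightSpan K V k p,
      ∃ w ∈ weightSpan K V 1 p, symBracket (symCoeff K) (toAlg K V w) = u := by
    intro m
    induction m with
    | zero =>
      intro k hk hkp u hu
      rw [weightSpan_eq_bot (by omega), Submodule.mem_bot] at hu
      exact ⟨0, zero_mem _, by simp [hu]⟩
    | succ m ih =>
      intro k hk hkp u hu
      -- Here k = p - 1, and the multiplier p is not invertible; but the space is zero, as p factors
      -- would need degree 2p.
      rcases Nat.eq_zero_or_pos m with rfl | hm
      · rw [weightSpan_eq_bot (by omega), Submodule.mem_bot] at hu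
        exact ⟨0, zero_mem _, by simp [hu]⟩
      have hne : ((k + 1 : ℕ) : K) ≠ 0 := by
        rw [Ne, CharP.cast_eq_zero_iff K p]
        exact Nat.not_dvd_of_pos_of_lt (Nat.succ_pos _) (by omega)
      -- The error φu - (k+1)u lies one level deeper, so it has a preimage w; then (k+1)⁻¹(u - w) is
      -- a preimage of u.
      obtain ⟨w, hw, h⟩ := ih (k + 1) (by omega) (by omega) _
        (symBracket_sub_mem hp (by omega) le_rfl hu)
      refine ⟨((k + 1 : ℕ) : K)⁻¹ • (u - w),
        Submodule.smul_mem _ _ (sub_mem (weightSpan_le_one hk p hu) hw), ?_⟩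
      rw [map_smul, map_smul, map_sub, map_sub, h, sub_sub_cancel, smul_smul,
        inv_mul_cancel₀ hne, one_smul]
  exact key (p - 1) 1 le_rfl (by have := hp.two_le; omega) u hu

end Bijective

/-! ### Projectivity of the tensor powers of a free module -/

section TensorProjective

variable {K V : Type*} [CommRing K] [AddCommGroup V] [Module K V]

variable (K V) in
/-- The map `v, a₁ ⊗ ⋯ ⊗ aₙ ↦ v ⊗ a₁ ⊗ ⋯ ⊗ aₙ`. -/
def consTensor (n : ℕ) : V →ₗ[K] (⨂[K]^n V) →ₗ[K] ⨂[K]^(n + 1) V :=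
  (PiTensorProduct.lift (R := K) (s := fun _ : Fin n => V)
    (E := ⨂[K]^(n + 1) V)).toLinearMap ∘ₗ
    (PiTensorProduct.tprod K (s := fun _ : Fin (n + 1) => V)).curryLeft

theorem consTensor_tprod {n : ℕ} (v : V) (a : Fin n → V) :
    consTensor K V n v (PiTensorProduct.tprod K a) =
      PiTensorProduct.tprod K (Fin.cons v a : Fin (n + 1) → V) := by
  simp [consTensor]

/-- The linear map on the `(n + 1)`-st tensor power that is given by a bilinear map on
`V × Tⁿ(V)`. -/
def unconsTensor {N : Type*} [AddCommGroup N] [Module K N] {n : ℕ}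
    (G : V →ₗ[K] (⨂[K]^n V) →ₗ[K] N) : (⨂[K]^(n + 1) V) →ₗ[K] N :=
  PiTensorProduct.lift (LinearMap.uncurryLeft (M := fun _ : Fin (n + 1) => V)
    ((PiTensorProduct.lift (R := K) (s := fun _ : Fin n => V) (E := N)).symm.toLinearMap ∘ₗ G))

theorem unconsTensor_consTensor {N : Type*} [AddCommGroup N] [Module K N] {n : ℕ}
    (G : V →ₗ[K] (⨂[K]^n V) →ₗ[K] N) (v : V) (t : ⨂[K]^n V) :
    unconsTensor G (consTensor K V n v t) = G v t := by
  have h : unconsTensor G ∘ₗ consTensor K V n v = G v := by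
    ext a
    simp [consTensor_tprod, unconsTensor]
  exact LinearMap.congr_fun h t

theorem consTensor_induction {n : ℕ} {P : (⨂[K]^(n + 1) V) → Prop}
    (add : ∀ s t, P s → P t → P (s + t))
    (cons : ∀ v t, P (consTensor K V n v t)) (t : ⨂[K]^(n + 1) V) : P t := by
  induction t using PiTensorProduct.induction_on with
  | smul_tprod c a =>
    have := cons (c • a 0) (PiTensorProduct.tprod K (Fin.tail a))
    rwa [map_smul, LinearMap.smul_apply, consTensor_tprod, Fin.cons_self_tail] at this
  | add s t hs ht => exact add s t hs ht

theorem tensorDer_consTensor (f : Module.End K V) {n : ℕ} (v : V) (t : ⨂[K]^n V) :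
    tensorDer f (n + 1) (consTensor K V n v t) =
      consTensor K V n (f v) t + consTensor K V n v (tensorDer f n t) := by
  have h : tensorDer f (n + 1) ∘ₗ consTensor K V n v =
      consTensor K V n (f v) + consTensor K V n v ∘ₗ tensorDer f n := by
    ext a
    simp only [LinearMap.compMultilinearMap_apply, LinearMap.comp_apply, LinearMap.add_apply,
      consTensor_tprod, tensorDer_tprod, map_sum, Fin.sum_univ_succ, Fin.cons_zero, Fin.cons_succ,
      Fin.update_cons_zero, Fin.cons_update]
  exact LinearMap.congr_fun h t

variable {σ : Type*}

theorem map_polynomial_smul {M N : Type*} [AddCommGroup M] [Module K M]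
    [Module (MvPolynomial σ K) M] [IsScalarTower K (MvPolynomial σ K) M] [AddCommGroup N]
    [Module K N] [Module (MvPolynomial σ K) N] [IsScalarTower K (MvPolynomial σ K) N]
    (f : M →ₗ[K] N)
    (hf : ∀ (x : σ) m, f ((MvPolynomial.X x : MvPolynomial σ K) • m) =
      (MvPolynomial.X x : MvPolynomial σ K) • f m) (q : MvPolynomial σ K) (m : M) :
    f (q • m) = q • f m := by
  induction q using MvPolynomial.induction_on generalizing m with
  | C a => simp only [← MvPolynomial.algebraMap_eq, algebraMap_smul, map_smul]
  | add q r hq hr => simp only [add_smul, map_add, hq, hr]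
  | mul_X q x hq => simp only [mul_smul, hq, hf]

/-- A `K`-linear map that commutes with the indeterminates is `K[σ]`-linear. -/
def polynomialLinear {M N : Type*} [AddCommGroup M] [Module K M]
    [Module (MvPolynomial σ K) M] [IsScalarTower K (MvPolynomial σ K) M] [AddCommGroup N]
    [Module K N] [Module (MvPolynomial σ K) N] [IsScalarTower K (MvPolynomial σ K) N]
    (f : M →ₗ[K] N)
    (hf : ∀ (x : σ) m, f ((MvPolynomial.X x : MvPolynomial σ K) • m) =
      (MvPolynomial.X x : MvPolynomial σ K) • f m) : M →ₗ[MvPolynomial σ K] N where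
  toFun := f
  map_add' := map_add f
  map_smul' := map_polynomial_smul f hf

variable [Module (MvPolynomial σ K) V] [IsScalarTower K (MvPolynomial σ K) V]

theorem X_smul_tensor (n : ℕ) (x : σ) (t : ⨂[K]^n V) :
    (MvPolynomial.X x : MvPolynomial σ K) • t = tensorDer (mulX K V x) n t := by
  rw [tensor_smul_def, polyAct_X]

section Twisted

variable (V) {N : Type*} [AddCommGroup N] [Module K N] [Module (MvPolynomial σ K) N]
  [IsScalarTower K (MvPolynomial σ K) N]

/-- The operator `φ ↦ x ∘ φ - φ ∘ x` on the linear maps from a tensor power to `N`. -/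
def twistedOp (n : ℕ) (x : σ) : Module.End K ((⨂[K]^n V) →ₗ[K] N) where
  toFun φ := mulX K N x ∘ₗ φ - φ ∘ₗ tensorDer (mulX K V x) n
  map_add' φ ψ := by ext; simp; abel
  map_smul' c φ := by ext; simp [smul_sub]

theorem twistedOp_apply (n : ℕ) (x : σ) (φ : (⨂[K]^n V) →ₗ[K] N) (t : ⨂[K]^n V) :
    twistedOp V n x φ t =
      (MvPolynomial.X x : MvPolynomial σ K) • φ t - φ (tensorDer (mulX K V x) n t) := rfl

theorem twistedOp_comm (n : ℕ) (x y : σ) :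
    (twistedOp V n x : Module.End K ((⨂[K]^n V) →ₗ[K] N)) * twistedOp V n y =
      twistedOp V n y * twistedOp V n x := by
  refine LinearMap.ext fun φ => LinearMap.ext fun t => ?_
  have h := LinearMap.congr_fun
    (tensorDer_comm (mulX K V x) (mulX K V y) (mulX_comm x y) n) t
  simp only [Module.End.mul_apply] at h
  simp only [Module.End.mul_apply, twistedOp_apply, smul_sub, h]
  rw [smul_comm (MvPolynomial.X x : MvPolynomial σ K)]
  abel

end Twisted

variable (σ K V) in
/-- The free `K[σ]`-module on the vector space `Tⁿ(V)`. -/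
abbrev freeCover (n : ℕ) : Type _ := MvPolynomial σ K ⊗[K] (⨂[K]^n V)

variable (σ K V) in
/-- The canonical map from the free `K[σ]`-module on `Tⁿ(V)` to `Tⁿ(V)`. -/
def coverMap (n : ℕ) : freeCover K V σ n →ₗ[MvPolynomial σ K] ⨂[K]^n V :=
  LinearMap.liftBaseChange (MvPolynomial σ K) LinearMap.id

theorem coverMap_one_tmul (n : ℕ) (t : ⨂[K]^n V) : coverMap K V σ n (1 ⊗ₜ t) = t := by
  simp [coverMap]

variable {I : Type*} (b : Module.Basis I (MvPolynomial σ K) V)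

/-- The extension of the maps `bᵢ ↦ (t ↦ 1 ⊗ (bᵢ ⊗ t))` to a map on `V` that is linear for the
twisted action. -/
def sectionAux (n : ℕ) : V →ₗ[K] (⨂[K]^n V) →ₗ[K] freeCover K V σ (n + 1) :=
  Finsupp.lsum K (fun i => (polyAct (twistedOp V (N := freeCover K V σ (n + 1)) n)
      (twistedOp_comm V n)).toLinearMap.flip
      (TensorProduct.mk K (MvPolynomial σ K) (⨂[K]^(n + 1) V) 1 ∘ₗ consTensor K V n (b i))) ∘ₗ
    (b.repr.toLinearMap.restrictScalars K)

theorem sectionAux_basis (n : ℕ) (i : I) (t : ⨂[K]^n V) :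
    sectionAux b n (b i) t = 1 ⊗ₜ consTensor K V n (b i) t := by
  simp [sectionAux]

/-- With the commutator action on the linear maps from Tⁿ(V) to N, K[σ]-linear maps from V into that
space correspond to K[σ]-linear maps on V ⊗ Tⁿ(V) with the derivation action. Such a map may be
prescribed on a basis of V. -/
theorem sectionAux_X_smul (n : ℕ) (x : σ) (v : V) :
    sectionAux b n ((MvPolynomial.X x : MvPolynomial σ K) • v) =
      twistedOp V n x (sectionAux b n v) := by
  rw [sectionAux, LinearMap.comp_apply, LinearMap.comp_apply]
  simp only [LinearMap.coe_restrictScalars, LinearEquiv.coe_coe, map_smul]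
  induction b.repr v using Finsupp.induction_linear with
  | zero => simp
  | add f g hf hg => rw [smul_add, map_add, map_add, map_add, hf, hg]
  | single i q =>
    simp only [Finsupp.smul_single, Finsupp.lsum_single, LinearMap.flip_apply, smul_eq_mul,
      AlgHom.toLinearMap_apply, map_mul, polyAct_X, Module.End.mul_apply]

theorem coverMap_sectionAux (n : ℕ) (v : V) (t : ⨂[K]^n V) :
    coverMap K V σ (n + 1) (sectionAux b n v t) = consTensor K V n v t := by
  have hq : ∀ (q : MvPolynomial σ K) (v : V),
      (∀ t, coverMap K V σ (n + 1) (sectionAux b n v t) = consTensor K V n v t) →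
      ∀ t, coverMap K V σ (n + 1) (sectionAux b n (q • v) t) = consTensor K V n (q • v) t := by
    intro q
    induction q using MvPolynomial.induction_on with
    | C a =>
      intro v hv t
      rw [← MvPolynomial.algebraMap_eq, algebraMap_smul, map_smul, map_smul,
        LinearMap.smul_apply, LinearMap.smul_apply, ← hv t]
      exact LinearMap.map_smul_of_tower _ _ _
    | add q r hq hr =>
      intro v hv t
      simp only [add_smul, map_add, LinearMap.add_apply, hq v hv t, hr v hv t]
    | mul_X q x hq =>
      intro v hv t
      rw [mul_smul]
      refine hq _ (fun t => ?_) t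
      -- By Leibniz, x(v ⊗ t) - v ⊗ xt = xv ⊗ t, so agreement passes from v to xv.
      rw [sectionAux_X_smul, twistedOp_apply, map_sub, map_smul, hv, hv, X_smul_tensor,
        tensorDer_consTensor, add_sub_cancel_right, mulX_apply]
  have hv : v ∈ Submodule.span (MvPolynomial σ K) (Set.range b) := by rw [b.span_eq]; trivial
  induction hv using Submodule.span_induction generalizing t with
  | zero => simp
  | add x y _ _ hx hy => simp only [map_add, LinearMap.add_apply, hx, hy]
  | smul q x _ hx => exact hq q x hx t
  | mem v hv =>
    obtain ⟨i, rfl⟩ := hv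
    rw [sectionAux_basis, coverMap_one_tmul]

/-- A splitting of the canonical map from the free `K[σ]`-module on `Tⁿ⁺¹(V)` to `Tⁿ⁺¹(V)`. -/
def tensorSection (n : ℕ) : (⨂[K]^(n + 1) V) →ₗ[MvPolynomial σ K] freeCover K V σ (n + 1) :=
  polynomialLinear (unconsTensor (sectionAux b n)) fun x t => by
    induction t using consTensor_induction with
    | add s t hs ht => simp only [smul_add, map_add, hs, ht]
    | cons v t =>
      rw [X_smul_tensor, tensorDer_consTensor, map_add, unconsTensor_consTensor,
        unconsTensor_consTensor, unconsTensor_consTensor, mulX_apply, sectionAux_X_smul,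
        twistedOp_apply, sub_add_cancel]

theorem coverMap_comp_tensorSection (n : ℕ) :
    coverMap K V σ (n + 1) ∘ₗ tensorSection b n = LinearMap.id := by
  refine LinearMap.ext fun t => ?_
  induction t using consTensor_induction with
  | add s t hs ht => rw [map_add, map_add, hs, ht]
  | cons v t =>
    change coverMap K V σ (n + 1) (unconsTensor (sectionAux b n) (consTensor K V n v t)) = _
    rw [unconsTensor_consTensor, coverMap_sectionAux]
    rfl

end TensorProjective

/-- The cover is free because K is a field. Degree zero is left out: there the indeterminates act as
zero. -/
theorem tensorPower_projective {σ K V : Type*} [Field K] [AddCommGroup V] [Module K V]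
    [Module (MvPolynomial σ K) V] [IsScalarTower K (MvPolynomial σ K) V]
    [Module.Free (MvPolynomial σ K) V] (n : ℕ) :
    Module.Projective (MvPolynomial σ K) (⨂[K]^(n + 1) V) :=
  Module.Projective.of_split (tensorSection (Module.Free.chooseBasis (MvPolynomial σ K) V) n)
    (coverMap K V σ (n + 1)) (coverMap_comp_tensorSection _ n)

/-! ### The summand of the tensor power -/

section Summand

theorem toDirectSum_algDer {K V : Type*} [CommRing K] [AddCommGroup V] [Module K V]
    (f : Module.End K V) (t : TensorAlgebra K V) :
    TensorAlgebra.toDirectSum (algDer (TensorAlgebra.ι K ∘ₗ f) t) =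
      totalDer f (TensorAlgebra.toDirectSum t) := by
  have hι : ∀ v : V, totalDer f (TensorAlgebra.toDirectSum (TensorAlgebra.ι K v)) =
      TensorAlgebra.toDirectSum (TensorAlgebra.ι K (f v)) := by
    intro v
    rw [← toAlg_ι, ← toAlg_ι, toDirectSum_toAlg, toDirectSum_toAlg, ← toTensors_lieDer, lieDer_ι]
  have h1 : totalDer f (1 : ⨁ n, ⨂[K]^n V) = 0 := by
    have := totalDer_mul f (1 : ⨁ n, ⨂[K]^n V) 1
    simpa using this
  induction t using tensorAlgebra_left_induction with
  | one => simp [h1]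
  | add s t hs ht => simp only [map_add, hs, ht]
  | smul c t ht => simp only [map_smul, ht]
  | ι_mul v t ht =>
    simp only [algDer_mul, algDer_ι, map_add, map_mul, totalDer_mul, ht, hι, LinearMap.comp_apply]

theorem toTensorAlgebra_tensorDer {K V : Type*} [Field K] [AddCommGroup V] [Module K V]
    (f : Module.End K V) (n : ℕ) (t : ⨂[K]^n V) :
    TensorPower.toTensorAlgebra (tensorDer f n t) =
      algDer (TensorAlgebra.ι K ∘ₗ f) (TensorPower.toTensorAlgebra t) := by
  rw [← ofDirectSum_of, ← ofDirectSum_of, ← totalDer_of,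
    ← TensorAlgebra.ofDirectSum_toDirectSum (algDer (TensorAlgebra.ι K ∘ₗ f) _),
    toDirectSum_algDer, TensorAlgebra.toDirectSum_ofDirectSum]

theorem toTensorAlgebra_mem_words {K V : Type*} [CommRing K] [AddCommGroup V] [Module K V]
    {n : ℕ} (t : ⨂[K]^n V) : TensorPower.toTensorAlgebra t ∈ words K V n := by
  induction t using PiTensorProduct.induction_on with
  | smul_tprod c a =>
    rw [map_smul, TensorPower.toTensorAlgebra_tprod, TensorAlgebra.tprod_apply]
    refine Submodule.smul_mem _ _ (Submodule.subset_span ⟨List.ofFn a, by simp, ?_⟩)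
    simp [word, List.map_ofFn, Function.comp_def]
  | add s t hs ht => rw [map_add]; exact add_mem hs ht

variable (σ K V : Type*) [Field K] [AddCommGroup V] [Module K V]
  [Module (MvPolynomial σ K) V] [IsScalarTower K (MvPolynomial σ K) V]

/-- The symmetrized bracketing on a tensor power, as a `K[σ]`-linear map. -/
def tensorSymBracket (n : ℕ) : (⨂[K]^n V) →ₗ[MvPolynomial σ K] FreeLie K V :=
  polynomialLinear (symBracket (symCoeff K) ∘ₗ TensorPower.toTensorAlgebra) fun x t => by
    rw [X_smul_tensor, LinearMap.comp_apply, LinearMap.comp_apply, toTensorAlgebra_tensorDer,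
      ← lieDer_symBracket, lie_smul_def, polyAct_X]
    rfl

theorem tensorSymBracket_toTensorPower {n : ℕ} {u : FreeLie K V}
    (hu : u ∈ liePowerSpan K V n) :
    tensorSymBracket σ K V n (toTensorPower σ K V n u) =
      symBracket (symCoeff K) (toAlg K V u) := by
  rw [toAlg_eq_of_tensorPart hu]
  rfl

variable {p : ℕ} [CharP K p]

theorem mem_metabKernel_iff (hp : p.Prime) {u : FreeLie K V} :
    u ∈ metabKernel σ K V p ↔ u ∈ weightSpan K V 1 p :=
  ⟨fun h => mem_weightSpan_one hp le_rfl h.1 h.2,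
    fun h => ⟨weightSpan_le 1 p h, mem_derivedSeries_two_of_mem_weightSpan h⟩⟩

theorem tensorSymBracket_mem (hp : p.Prime) (t : ⨂[K]^p V) :
    tensorSymBracket σ K V p t ∈ metabKernel σ K V p :=
  (mem_metabKernel_iff σ K V hp).2 (symBracket_mem_weightSpan hp (toTensorAlgebra_mem_words t))

/-- A map that carries T^p into B^p and is bijective on B^p splits off its kernel as a complement.
-/
theorem metabKernel_isCompl (hp : p.Prime) :
    IsCompl ((metabKernel σ K V p).map (toTensorPower σ K V p))
      (LinearMap.ker (tensorSymBracket σ K V p)) := by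
  constructor
  · rw [Submodule.disjoint_def]
    rintro _ ⟨u, hu, rfl⟩ h
    have hu := (mem_metabKernel_iff σ K V hp).1 hu
    rw [LinearMap.mem_ker, tensorSymBracket_toTensorPower σ K V (weightSpan_le 1 p hu)] at h
    rw [eq_zero_of_symBracket_eq_zero hp hu h, map_zero]
  · rw [codisjoint_iff, eq_top_iff]
    intro t _
    obtain ⟨w, hw, h⟩ := exists_symBracket_eq hp
      ((mem_metabKernel_iff σ K V hp).1 (tensorSymBracket_mem σ K V hp t))
    rw [← add_sub_cancel (toTensorPower σ K V p w) t]
    refine Submodule.add_mem_sup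
      (Submodule.mem_map_of_mem ((mem_metabKernel_iff σ K V hp).2 hw)) ?_
    rw [LinearMap.mem_ker, map_sub, tensorSymBracket_toTensorPower σ K V (weightSpan_le 1 p hw), h,
      sub_self]

theorem metabKernel_projective (hp : p.Prime) [Module.Free (MvPolynomial σ K) V] :
    Module.Projective (MvPolynomial σ K) (metabKernel σ K V p) := by
  have : Module.Projective (MvPolynomial σ K) (⨂[K]^p V) := by
    obtain ⟨n, hn⟩ := Nat.exists_eq_succ_of_ne_zero hp.ne_zero
    rw [hn]
    exact tensorPower_projective n
  let i : metabKernel σ K V p →ₗ[MvPolynomial σ K] ⨂[K]^p V :=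
    toTensorPower σ K V p ∘ₗ (metabKernel σ K V p).subtype
  let r : (⨂[K]^p V) →ₗ[MvPolynomial σ K] metabKernel σ K V p :=
    (tensorSymBracket σ K V p).codRestrict _ (tensorSymBracket_mem σ K V hp)
  have hri : ∀ u, (r (i u) : FreeLie K V) = symBracket (symCoeff K) (toAlg K V u) := fun u =>
    tensorSymBracket_toTensorPower σ K V u.2.1
  have hb : Function.Bijective (r ∘ₗ i) := by
    constructor
    · rw [injective_iff_map_eq_zero]
      intro u hu
      refine Subtype.ext (eq_zero_of_symBracket_eq_zero hp ((mem_metabKernel_iff σ K V hp).1 u.2) ?_)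
      rw [← hri]
      exact congrArg Subtype.val hu
    · intro u
      obtain ⟨w, hw, h⟩ := exists_symBracket_eq hp ((mem_metabKernel_iff σ K V hp).1 u.2)
      exact ⟨⟨w, (mem_metabKernel_iff σ K V hp).2 hw⟩, Subtype.ext ((hri _).trans h)⟩
  -- The composite r ∘ i is only bijective, not the identity, so the retraction is r followed by the
  -- inverse of r ∘ i.
  refine Module.Projective.of_split i ((LinearEquiv.ofBijective _ hb).symm.toLinearMap ∘ₗ r) ?_
  exact LinearMap.ext fun u => (LinearEquiv.ofBijective _ hb).symm_apply_apply u

end Summand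

end LiePower

end

theorem lemma4p1 {p : ℕ} (hp : p.Prime) {K : Type*} [Field K] [CharP K p]
    {σ : Type*} [Finite σ] {V : Type*} [AddCommGroup V] [Module K V]
    [Module (MvPolynomial σ K) V] [IsScalarTower K (MvPolynomial σ K) V] :
    Set.InjOn (LiePower.toTensorPower σ K V p) (LiePower.liePower σ K V p) ∧
    (∃ C : Submodule (MvPolynomial σ K) (⨂[K]^p V),
      IsCompl ((LiePower.metabKernel σ K V p).map (LiePower.toTensorPower σ K V p)) C) ∧
    (Module.Free (MvPolynomial σ K) V →
      Module.Projective (MvPolynomial σ K) (LiePower.metabKernel σ K V p)) :=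
  ⟨LiePower.tensorPart_injOn hp, ⟨_, LiePower.metabKernel_isCompl σ K V hp⟩,
    fun _ => LiePower.metabKernel_projective σ K V hp⟩
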